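/- Let $\Bbbk$ be an algebraically closed field of characteristic $0$, let $R$ be a connected affine algebraic group over $\Bbbk$ with Lie algebra $\mathfrak r$, and let $R$ act on $\mathfrak r^*$ by the coadjoint representation. For $\xi\in\mathfrak r^*$ put $\mathfrak r_\xi=\{x\in\mathfrak r\mid \xi([x,y])=0 \text{ for all } y\in\mathfrak r\}$, and let $\operatorname{ind}\mathfrak r=\min_{\xi\in\mathfrak r^*}\dim\mathfrak r_\xi$ be the index of $\mathfrak r$. Let $\mathfrak r^*_{reg}$ be the set of those $\xi\in\mathfrak r^*$ whose orbit $R\cdot\xi$ has maximal dimension among all coadjoint orbits. Suppose that (a) $\operatorname{ind}\mathfrak r=m$; (b) $\Bbbk[\mathfrak r^*]^R=\Bbbk[p_1,\dots,p_m]$, where $p_1,\dots,p_m$ are homogeneous and algebraically independent polynomials; (c) $\sum_{i=1}^m\deg p_i=(\dim\mathfrak r+\operatorname{ind}\mathfrak r)/2$. Let $\mathcal Y(\mathfrak r^*)$ be the set of all $\xi\in\mathfrak r^*$ at which the differentials $(dp_1)_\xi,\dots,(dp_m)_\xi$ are linearly independent. Then the following conditions are equivalent: 1) $\operatorname{codim}(\mathfrak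 r^*\setminus\mathfrak r^*_{reg})\ge 2$; 2) $\operatorname{codim}(\mathfrak r^*\setminus\mathcal Y(\mathfrak r^*))\ge 2$. If these conditions are satisfied, then $\mathfrak r^*_{reg}=\mathcal Y(\mathfrak r^*)$. (The empty set has codimension $\infty$.) -/

import Mathlib

/-!
Affine algebraic groups over an algebraically closed field `k` of characteristic zero are given by
their coordinate rings `A = k[R]`: reduced commutative Hopf algebras of finite type over `k`.
-/

noncomputable section

open scoped TensorProduct

namespace AlgGroup

section Group

variable (k A : Type*) [Field k] [CommRing A] [HopfAlgebra k A]

/-- The group `R = Hom_{k-alg}(k[R], k)` of `k`-points of the algebraic group with coordinate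
ring `A`. Its group structure is Mathlib's convolution structure: `(g * h)(f) = (g ⊗ h)(Δ f)`. -/
abbrev Points : Type _ := WithConv (A →ₐ[k] k)

/-- The Lie algebra of the algebraic group with coordinate ring `A`: the left-invariant
`k`-derivations `D` of `A`, i.e. those with `Δ ∘ D = (id ⊗ D) ∘ Δ`, under the commutator bracket. -/
def lieAlg : LieSubalgebra k (Derivation k A A) where
  carrier := {D | ∀ f : A, Coalgebra.comul (R := k) (D f) =
    (D : A →ₗ[k] A).lTensor A (Coalgebra.comul f)}
  zero_mem' := fun f => by simp
  add_mem' := fun {D E} hD hE f => by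
    simp [hD f, hE f, LinearMap.lTensor_add]
  smul_mem' := fun c D hD f => by
    simp [hD f, LinearMap.lTensor_smul]
  lie_mem' := fun {D E} hD hE f => by
    have h : ((⁅D, E⁆ : Derivation k A A) : A →ₗ[k] A) =
        (D : A →ₗ[k] A) ∘ₗ (E : A →ₗ[k] A) - (E : A →ₗ[k] A) ∘ₗ (D : A →ₗ[k] A) := by
      ext x; exact Derivation.commutator_apply (D1 := D) (D2 := E) x
    rw [h, LinearMap.lTensor_sub, LinearMap.lTensor_comp, LinearMap.lTensor_comp]
    simp only [LinearMap.sub_apply, LinearMap.comp_apply]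
    rw [Derivation.commutator_apply, map_sub, hD, hE f, hE (D f), hD f]

variable {k A}

/-- Right translation of functions by the point `g`: `(ρ_g f)(x) = f(x g)`. -/
def rightTranslation (g : Points k A) : A →ₐ[k] A :=
  (Algebra.TensorProduct.rid k k A).toAlgHom.comp
    ((Algebra.TensorProduct.map (AlgHom.id k A) g.ofConv).comp (Bialgebra.comulAlgHom k A))

theorem rightTranslation_apply (g : Points k A) (f : A) :
    rightTranslation g f = TensorProduct.rid k A
      (g.ofConv.toLinearMap.lTensor A (Coalgebra.comul f)) := rfl

theorem rightTranslation_one : rightTranslation (1 : Points k A) = AlgHom.id k A := by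
  ext f
  have h : (1 : Points k A).ofConv.toLinearMap = Coalgebra.counit := by
    ext x; rfl
  rw [rightTranslation_apply, h, Coalgebra.lTensor_counit_comul]
  simp

/-- Right translations commute with left translations. -/
theorem comul_rightTranslation (g : Points k A) (f : A) :
    Coalgebra.comul (R := k) (rightTranslation g f) =
      (rightTranslation g).toLinearMap.lTensor A (Coalgebra.comul f) := by
  have h1 : ∀ t : A ⊗[k] A, Coalgebra.comul (R := k)
      (TensorProduct.rid k A (g.ofConv.toLinearMap.lTensor A t)) =
      ((TensorProduct.rid k A).toLinearMap ∘ₗ g.ofConv.toLinearMap.lTensor A).lTensor A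
        (TensorProduct.assoc k A A A (Coalgebra.comul.rTensor A t)) := by
    intro t
    induction t with
    | zero => simp
    | add x y hx hy => simp only [map_add, hx, hy]
    | tmul x y =>
      simp only [LinearMap.lTensor_tmul, TensorProduct.rid_tmul, map_smul, LinearMap.rTensor_tmul]
      generalize (Coalgebra.comul (R := k) x) = u
      induction u with
      | zero => simp
      | add x y hx hy => simp only [smul_add, TensorProduct.add_tmul, map_add, hx, hy]
      | tmul v w => simp [TensorProduct.tmul_smul]
  rw [rightTranslation_apply, h1, Coalgebra.coassoc_apply, ← LinearMap.comp_apply,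
    ← LinearMap.lTensor_comp]
  rfl

theorem rightTranslation_mul (g h : Points k A) :
    rightTranslation (g * h) = (rightTranslation g).comp (rightTranslation h) := by
  ext f
  have h1 : ∀ t : A ⊗[k] A, TensorProduct.rid k A (g.ofConv.toLinearMap.lTensor A
      ((rightTranslation h).toLinearMap.lTensor A t)) =
      TensorProduct.rid k A ((g * h).ofConv.toLinearMap.lTensor A t) := by
    intro t
    induction t with
    | zero => simp
    | add x y hx hy => simp only [map_add, hx, hy]
    | tmul x y =>
      simp only [LinearMap.lTensor_tmul, TensorProduct.rid_tmul, AlgHom.toLinearMap_apply]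
      congr 1
      rw [rightTranslation_apply]
      change _ = (g * h) y
      rw [AlgHom.convMul_apply]
      generalize (Coalgebra.comul (R := k) y) = u
      induction u with
      | zero => simp
      | add x y hx hy => simp only [map_add, hx, hy]
      | tmul v w => simp [mul_comm]
  rw [AlgHom.comp_apply, rightTranslation_apply, rightTranslation_apply g, comul_rightTranslation,
    h1]

/-- The adjoint action `Ad(g) D = ρ_g ∘ D ∘ ρ_g⁻¹` of the group on its Lie algebra. -/
def Ad (g : Points k A) : lieAlg k A →ₗ[k] lieAlg k A where
  toFun D := ⟨Derivation.mk' ((rightTranslation g).toLinearMap ∘ₗ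
      ((D : Derivation k A A) : A →ₗ[k] A) ∘ₗ (rightTranslation g⁻¹).toLinearMap) (by
        intro a b
        have h : ∀ x, rightTranslation g (rightTranslation g⁻¹ x) = x := fun x => by
          have := rightTranslation_mul g g⁻¹
          rw [mul_inv_cancel, rightTranslation_one] at this
          exact (DFunLike.congr_fun this x).symm
        simp [h]), by
      intro f
      have hD := D.2
      change ∀ f : A, _ = _ at hD
      change Coalgebra.comul (R := k) (rightTranslation g ((D : Derivation k A A)
        (rightTranslation g⁻¹ f))) = LinearMap.lTensor A ((rightTranslation g).toLinearMap ∘ₗ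
          ((D : Derivation k A A) : A →ₗ[k] A) ∘ₗ (rightTranslation g⁻¹).toLinearMap) _
      rw [comul_rightTranslation, hD, comul_rightTranslation, LinearMap.lTensor_comp,
        LinearMap.lTensor_comp]
      rfl⟩
  map_add' D E := by
    ext x
    exact (congrArg (rightTranslation g) rfl).trans (map_add (rightTranslation g) _ _)
  map_smul' c D := by
    ext x
    exact (congrArg (rightTranslation g) rfl).trans (map_smul (rightTranslation g) c _)

/-- The coadjoint action `(g · ξ)(x) = ξ(Ad(g⁻¹) x)` of the group on the dual of its Lie algebra. -/
def coAd (g : Points k A) (ξ : Module.Dual k (lieAlg k A)) : Module.Dual k (lieAlg k A) :=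
  ξ ∘ₗ Ad g⁻¹

/-- The coadjoint orbit of `ξ`. -/
def coadjointOrbit (ξ : Module.Dual k (lieAlg k A)) : Set (Module.Dual k (lieAlg k A)) :=
  Set.range fun g : Points k A => coAd g ξ

end Group

section Index

variable (k L : Type*) [Field k] [LieRing L] [LieAlgebra k L]

variable {k L} in
/-- The stabiliser `{x ∈ L | ξ([x, y]) = 0 for all y ∈ L}` of `ξ ∈ L*` under the coadjoint
representation of the Lie algebra `L`. -/
def coadjointStabilizer (ξ : Module.Dual k L) : Submodule k L where
  carrier := {x | ∀ y : L, ξ ⁅x, y⁆ = 0}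
  zero_mem' := fun y => by simp
  add_mem' := fun {x x'} hx hx' y => by simp [hx y, hx' y]
  smul_mem' := fun c x hx y => by simp [hx y]

/-- The index of a finite-dimensional Lie algebra: the minimal dimension of a stabiliser in the
coadjoint representation. -/
def index : ℕ :=
  sInf (Set.range fun ξ : Module.Dual k L => Module.finrank k (coadjointStabilizer ξ))

end Index

/-! A basis `b` of `V` identifies the algebra `k[V*]` of polynomial functions on the dual space `V*`
with the polynomial ring in the variables `X i`, where `X i` is the linear function `ξ ↦ ξ (b i)`. -/
section Polynomial

variable {k V ι : Type*} [Field k] [AddCommGroup V] [Module k V] (b : Module.Basis ι k V)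

/-- The coordinates of a point of `V*`. -/
def coords (ξ : Module.Dual k V) : ι → k := fun i => ξ (b i)

/-- The value at `ξ ∈ V*` of the polynomial function `p`. -/
def value (p : MvPolynomial ι k) (ξ : Module.Dual k V) : k := MvPolynomial.eval (coords b ξ) p

/-- The differential of the polynomial function `p` at `ξ ∈ V*`, as an element of `V = (V*)*`. -/
def differential [Fintype ι] (p : MvPolynomial ι k) (ξ : Module.Dual k V) : V :=
  ∑ i, value b (MvPolynomial.pderiv i p) ξ • b i

/-- The ideal in `k[V*]` of all polynomial functions that vanish on `Z ⊆ V*`. -/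
def idealOf (Z : Set (Module.Dual k V)) : Ideal (MvPolynomial ι k) :=
  MvPolynomial.vanishingIdeal k (coords b '' Z)

/-- The codimension in `V*` of (the Zariski closure of) `Z`: the height of the ideal of `Z`.
The empty set has codimension `⊤`. -/
def codim (Z : Set (Module.Dual k V)) : ℕ∞ := (idealOf b Z).height

/-- The dimension of a subset `Z ⊆ V*` with irreducible Zariski closure (such as an orbit of a
connected group): the transcendence degree over `k` of the coordinate ring of its closure. -/
def dimension (Z : Set (Module.Dual k V)) : Cardinal :=
  Algebra.trdeg k (MvPolynomial ι k ⧸ idealOf b Z)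

/-- The set `𝒴(V*)` of the points of `V*` at which the differentials of the functions `p j` are
linearly independent. -/
def independenceLocus [Fintype ι] {m : ℕ} (p : Fin m → MvPolynomial ι k) :
    Set (Module.Dual k V) :=
  {ξ | LinearIndependent k fun j => differential b (p j) ξ}

end Polynomial

section Coadjoint

variable {k A ι : Type*} [Field k] [CommRing A] [HopfAlgebra k A]
  (b : Module.Basis ι k (lieAlg k A))

/-- The set of regular elements of the dual of the Lie algebra: those whose coadjoint orbit has
maximal dimension. -/
def regularLocus : Set (Module.Dual k (lieAlg k A)) :=
  {ξ | ∀ η, dimension b (coadjointOrbit η) ≤ dimension b (coadjointOrbit ξ)}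

/-- The algebra of polynomial functions on the dual of the Lie algebra that are invariant under the
coadjoint action of the group. -/
def invariants : Subalgebra k (MvPolynomial ι k) where
  carrier := {p | ∀ (g : Points k A) (ξ : Module.Dual k (lieAlg k A)),
    value b p (coAd g ξ) = value b p ξ}
  mul_mem' := fun {p q} hp hq g ξ => by
    have h1 := hp g ξ
    have h2 := hq g ξ
    simp only [value, map_mul] at *
    rw [h1, h2]
  add_mem' := fun {p q} hp hq g ξ => by
    have h1 := hp g ξ
    have h2 := hq g ξ
    simp only [value, map_add] at *
    rw [h1, h2]
  algebraMap_mem' := fun c g ξ => by simp [value, MvPolynomial.algebraMap_eq]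

end Coadjoint

end AlgGroup

end

/-!
The equivalence rests on one identity between polynomials on the dual `r*` of the Lie algebra. Let
`n = dim r`, let `Π = (⁅b i, b j⁆)` be the Lie–Poisson matrix, a skew-symmetric matrix of linear
forms on `r*`, and let `K = (∂ p j / ∂ x i)` be the Jacobian matrix of the generators. Since the
`p j` are invariant, `Π * K = 0` (`poissonMatrix_mul_jacobian`). For `σ : Fin m → ι` let `P σ` be
the determinant of `Π` bordered by the standard basis vectors with indices in `σ`, and let `Q σ` be
the minor of `K` on the rows in `σ`. Linear algebra over the field of fractions gives
`P σ * Q τ ^ 2 = P τ * Q σ ^ 2` (`bordered_mul_sq`). The forms `Q σ` have degree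
`∑ deg p j - m = (n - m) / 2` and the forms `P σ` have degree `n - m`, which is twice as much.

The regular locus is the locus where some `P σ` does not vanish (`mem_regularLocus_iff`), and the
independence locus is the locus where some `Q σ` does not vanish (`mem_independenceLocus_iff`).
Write `P σ / Q σ ^ 2 = α / β` in lowest terms; then `deg α = deg β`, all `P σ` vanish on the
hypersurface `α = 0` and all `Q σ` on the hypersurface `β = 0`. If one of the two complements has
codimension at least two, then one of `α`, `β` is constant, hence so is the other, and the two loci
coincide (`nonvanishing_eq_of_codim`).

Two facts about the group enter. The functions `g ↦ (g · ξ) (b l)` are regular functions on the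
group, whose derivatives along left-invariant vector fields are combinations of the entries of the
matrix `ξ ⁅b i, b j⁆` (`derivation_orbitMap`); evaluating at the identity shows that differentials
of invariants lie in stabilisers. Moreover the dimension of the orbit of `ξ` is the rank of this
matrix (`dimension_coadjointOrbit`): the lower bound is a Jacobian criterion at the identity, and
the upper bound holds because every derivation of the coordinate ring is a combination of
left-invariant ones (`exists_derivation_eq_sum`) while, in characteristic zero, derivations separate
algebraically independent elements (`exists_derivation_of_algebraicIndependent`). All of this is
carried out in the convolution algebras of linear maps from the Hopf algebra to commutative
algebras, in which a left-invariant derivation `D` is `id * d` with `d` its value at the identity,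
and `g ↦ Ad(g⁻¹) d` is `S * d * id` with `S` the antipode.
-/

noncomputable section

open scoped TensorProduct

universe u

namespace AlgGroup

/-! ### Derivations and algebraic independence -/

section FieldTheory

open MvPolynomial

/-- In characteristic zero, a derivation of a field may be prescribed arbitrarily on an
algebraically independent family: a field is formally étale over a polynomial ring in a
transcendence basis. -/
theorem exists_derivation_of_algebraicIndependent {k L σ : Type*} [Field k] [Field L] [CharZero k]
    [Algebra k L] {x : σ → L} (hx : AlgebraicIndependent k x) (v : σ → L) :
    ∃ E : Derivation k L L, ∀ i, E (x i) = v i := by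
  classical
  obtain ⟨t, hst, ht⟩ := exists_isTranscendenceBasis_superset hx.coe_range
  have := charZero_of_injective_algebraMap (algebraMap k L).injective
  have hinj : Function.Injective (aeval ((↑) : t → L) : MvPolynomial t k →ₐ[k] L) := ht.1
  let _ : Algebra (MvPolynomial t k) L := (aeval ((↑) : t → L)).toRingHom.toAlgebra
  have : IsScalarTower k (MvPolynomial t k) L :=
    .of_algebraMap_eq fun r => ((aeval ((↑) : t → L)).commutes r).symm
  have : FaithfulSMul (MvPolynomial t k) L :=
    (faithfulSMul_iff_algebraMap_injective _ _).2 hinj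
  let _ : Algebra (FractionRing (MvPolynomial t k)) L := FractionRing.liftAlgebra _ _
  have halg := ht.isAlgebraic
  have : Algebra.IsAlgebraic (FractionRing (MvPolynomial t k)) L := by
    refine halg.ringHom_of_comp_eq
      ((algebraMap (MvPolynomial t k) (FractionRing (MvPolynomial t k))).comp
      ht.1.aevalEquiv.symm.toRingEquiv.toRingHom) (RingHom.id L)
      ((IsFractionRing.injective (MvPolynomial t k) (FractionRing (MvPolynomial t k))).comp
        ht.1.aevalEquiv.symm.injective)
      Function.surjective_id ?_
    ext y
    obtain ⟨P, rfl⟩ := ht.1.aevalEquiv.surjective y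
    change algebraMap (FractionRing (MvPolynomial t k)) L (algebraMap _ _
      (ht.1.aevalEquiv.symm (ht.1.aevalEquiv P))) =
      (ht.1.aevalEquiv P : L)
    rw [AlgEquiv.symm_apply_apply, ← IsScalarTower.algebraMap_apply]
    exact (ht.1.algebraMap_aevalEquiv P).symm
  have : Algebra.FormallyEtale (MvPolynomial t k) (FractionRing (MvPolynomial t k)) :=
    .of_isLocalization (nonZeroDivisors _)
  have : Algebra.FormallyEtale (FractionRing (MvPolynomial t k)) L := .of_isSeparable _ _
  have : Algebra.FormallyEtale (MvPolynomial t k) L :=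
    .comp _ (FractionRing (MvPolynomial t k)) _
  let w : t → L := fun y => if h : ∃ i, x i = y then v h.choose else 0
  let E₀ : Derivation k (MvPolynomial t k) L := mkDerivation k w
  let φ := (E₀.liftKaehlerDifferential.liftBaseChange L) ∘ₗ
    (KaehlerDifferential.tensorKaehlerEquivOfFormallyEtale k (MvPolynomial t k) L).symm.toLinearMap
  refine ⟨φ.compDer (KaehlerDifferential.D k L), fun i => ?_⟩
  have hi : x i = algebraMap (MvPolynomial t k) L (X ⟨x i, hst ⟨i, rfl⟩⟩) :=
    (aeval_X ((↑) : t → L) ⟨x i, hst ⟨i, rfl⟩⟩).symm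
  have hw : w ⟨x i, hst ⟨i, rfl⟩⟩ = v i := by
    have h : ∃ j, x j = x i := ⟨i, rfl⟩
    simp only [w, h, dite_true]
    rw [hx.injective h.choose_spec]
  change φ (KaehlerDifferential.D k L (x i)) = _
  rw [hi]
  simp only [φ, LinearMap.comp_apply, LinearEquiv.coe_coe]
  rw [KaehlerDifferential.tensorKaehlerEquivOfFormallyEtale_symm_D_algebraMap]
  simp [E₀, mkDerivation_X, hw]

/-- An algebraically independent family in a commutative algebra stays algebraically independent
in the fraction field of some integral quotient. -/
theorem exists_algebraicIndependent_field {k σ : Type*} {A : Type u} [Field k] [CommRing A]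
    [Algebra k A] {x : σ → A} (hx : AlgebraicIndependent k x) :
    ∃ (L : Type u) (_ : Field L) (_ : Algebra k L) (_ : Algebra A L) (_ : IsScalarTower k A L),
      AlgebraicIndependent k (algebraMap A L ∘ x) := by
  obtain ⟨q, hq, -, hd⟩ := Ideal.exists_le_prime_disjoint (⊥ : Ideal A)
    ((nonZeroDivisors (MvPolynomial σ k)).map (aeval x)) (by
      rw [Set.disjoint_left]
      rintro _ h ⟨P, hP, rfl⟩
      exact nonZeroDivisors.ne_zero hP (hx.eq_zero_of_aeval_eq_zero _ h))
  refine ⟨FractionRing (A ⧸ q), inferInstance, inferInstance, inferInstance, inferInstance, ?_⟩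
  rw [algebraicIndependent_iff]
  intro P hP
  by_contra hne
  have h1 : aeval (algebraMap A (FractionRing (A ⧸ q)) ∘ x) P =
      algebraMap A (FractionRing (A ⧸ q)) (aeval x P) := by
    rw [← aeval_algebraMap_apply]
  rw [h1, IsScalarTower.algebraMap_apply A (A ⧸ q), 
    FaithfulSMul.algebraMap_eq_zero_iff, Ideal.Quotient.algebraMap_eq,
    Ideal.Quotient.eq_zero_iff_mem] at hP
  exact Set.disjoint_left.1 hd hP ⟨P, mem_nonZeroDivisors_of_ne_zero hne, rfl⟩

/-- In characteristic zero a polynomial with vanishing gradient is constant. -/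
theorem eq_C_of_pderiv_eq_zero {k σ : Type*} [Field k] [CharZero k]
    {P : MvPolynomial σ k} (h : ∀ i, pderiv i P = 0) : P = C (coeff 0 P) := by
  classical
  ext s
  rw [coeff_C]
  split_ifs with hs
  · rw [hs]
  · obtain ⟨i, hi⟩ : ∃ i, s i ≠ 0 := by
      by_contra! hc
      exact hs (Finsupp.ext fun i => (hc i).symm)
    have h1 := coeff_pderiv (i := i) P (s - Finsupp.single i 1)
    rw [h i, coeff_zero, tsub_add_cancel_of_le (by simpa using Nat.one_le_iff_ne_zero.2 hi)] at h1
    exact (mul_eq_zero.1 h1.symm).resolve_right (Nat.cast_add_one_ne_zero _)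

end FieldTheory

/-! ### Bordered determinants of skew-symmetric matrices -/

section LinearAlgebra

open Matrix

variable {n κ : Type*} [Fintype n] [DecidableEq n] [Fintype κ] [DecidableEq κ]

/-- For fixed `M` and `U`, the bordered determinant is proportional to `det (V * K)` as a function
of `V`, where the columns of `K` lie in the kernel of `M`. -/
theorem det_bordered_mul_det {F : Type*} [Field F] (M : Matrix n n F) (U : Matrix n κ F)
    (V V₀ : Matrix κ n F) (K : Matrix n κ F) (hK : M * K = 0) :
    (fromBlocks M U V 0).det * (V₀ * K).det = (fromBlocks M U V₀ 0).det * (V * K).det := by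
  -- If `N₀` is invertible, then `N * N₀⁻¹` is block triangular with lower right block `Q`,
  -- and `V * K = Q * (V₀ * K)`.
  have key : ∀ V V₀ : Matrix κ n F, (fromBlocks M U V₀ 0).det ≠ 0 →
      (fromBlocks M U V 0).det * (V₀ * K).det = (fromBlocks M U V₀ 0).det * (V * K).det := by
    intro V V₀ h
    have hu : IsUnit (fromBlocks M U V₀ 0).det := h.isUnit
    set N₀ := fromBlocks M U V₀ 0 with hN₀
    obtain ⟨T, hT⟩ : ∃ T, T = fromBlocks M U V 0 * N₀⁻¹ := ⟨_, rfl⟩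
    have hTN : T * N₀ = fromBlocks M U V 0 := by
      rw [hT, Matrix.mul_assoc, nonsing_inv_mul _ hu, Matrix.mul_one]
    obtain ⟨P, Q, hPQ⟩ : ∃ P Q, T = fromBlocks 1 0 P Q := by
      refine ⟨T.toBlocks₂₁, T.toBlocks₂₂, ?_⟩
      have h1 : ∀ i j, T (Sum.inl i) j = (1 : Matrix (n ⊕ κ) (n ⊕ κ) F) (Sum.inl i) j := by
        intro i j
        rw [← mul_nonsing_inv _ hu, hT, mul_apply, mul_apply]
        refine Finset.sum_congr rfl fun l _ => ?_
        rcases l with l | l <;> simp [hN₀]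
      ext (i | i) (j | j)
      · simp [h1, one_apply]
      · simp [h1]
      · simp [toBlocks₂₁]
      · simp [toBlocks₂₂]
    have hV : V = P * M + Q * V₀ := by
      rw [hPQ, hN₀, fromBlocks_multiply] at hTN
      exact (fromBlocks_inj.1 hTN).2.2.1.symm
    have hVK : V * K = Q * (V₀ * K) := by
      rw [hV, Matrix.add_mul, Matrix.mul_assoc, hK, Matrix.mul_zero, zero_add, Matrix.mul_assoc]
    rw [← hTN, hVK, det_mul, det_mul, hPQ, det_fromBlocks_zero₁₂, det_one]
    ring
  by_cases h : (fromBlocks M U V₀ 0).det = 0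
  · by_cases h' : (fromBlocks M U V 0).det = 0
    · rw [h, h', zero_mul, zero_mul]
    · exact (key V₀ V h').symm
  · exact key V V₀ h

/-- The bordered determinant of a square matrix `M` obtained by adjoining the standard basis
vectors with indices `σ` as columns and as rows. -/
def bordered {R : Type*} [CommRing R] (M : Matrix n n R) (σ : κ → n) : R :=
  (fromBlocks M ((1 : Matrix n n R).submatrix id σ) ((1 : Matrix n n R).submatrix σ id) 0).det

theorem map_bordered {R R' : Type*} [CommRing R] [CommRing R'] (f : R →+* R') (M : Matrix n n R)
    (σ : κ → n) : f (bordered M σ) = bordered (M.map f) σ := by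
  rw [bordered, bordered, RingHom.map_det, RingHom.mapMatrix_apply, fromBlocks_map]
  congr 2 <;> ext i j <;> simp [one_apply, apply_ite f]

/-- For a skew-symmetric matrix `M` over a domain and a matrix `K` of kernel vectors, the bordered
determinants of `M` are proportional to the squares of the maximal minors of `K`. -/
theorem bordered_mul_sq {R : Type*} [CommRing R] [IsDomain R] (M : Matrix n n R) (hM : Mᵀ = -M)
    (K : Matrix n κ R) (hK : M * K = 0) (σ τ : κ → n) :
    bordered M σ * (K.submatrix τ id).det ^ 2 = bordered M τ * (K.submatrix σ id).det ^ 2 := by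
  have field : ∀ {F : Type _} [Field F] (M : Matrix n n F) (_ : Mᵀ = -M) (K : Matrix n κ F)
      (_ : M * K = 0), bordered M σ * (K.submatrix τ id).det ^ 2 =
        bordered M τ * (K.submatrix σ id).det ^ 2 := by
    intro F _ M hM K hK
    let U (σ : κ → n) : Matrix n κ F := (1 : Matrix n n F).submatrix id σ
    let V (σ : κ → n) : Matrix κ n F := (1 : Matrix n n F).submatrix σ id
    have hVK : ∀ σ, V σ * K = K.submatrix σ id := fun σ => by
      simpa using (submatrix_mul_equiv (1 : Matrix n n F) K σ (Equiv.refl n) id)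
    have h1 := det_bordered_mul_det M (U σ) (V σ) (V τ) K hK
    have h2 := det_bordered_mul_det Mᵀ (V τ)ᵀ (U σ)ᵀ (U τ)ᵀ K (by
      rw [hM, Matrix.neg_mul, hK, neg_zero])
    have hUt : ∀ σ, (U σ)ᵀ = V σ := fun σ => by simp [U, V, transpose_submatrix]
    have hdet : ∀ σ τ, (fromBlocks Mᵀ (V τ)ᵀ (U σ)ᵀ 0).det = (fromBlocks M (U σ) (V τ) 0).det := by
      intro σ τ
      rw [← det_transpose (fromBlocks M _ _ _), fromBlocks_transpose, transpose_zero]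
    rw [hdet, hdet, hUt, hUt, hVK, hVK] at h2
    rw [hVK, hVK] at h1
    change (fromBlocks M (U σ) (V σ) 0).det * _ = (fromBlocks M (U τ) (V τ) 0).det * _
    linear_combination (K.submatrix τ id).det * h1 + (K.submatrix σ id).det * h2
  have hinj := IsFractionRing.injective R (FractionRing R)
  set f := algebraMap R (FractionRing R)
  refine hinj ?_
  have h := field (M.map f) (by rw [← transpose_map, hM]; ext; simp) (K.map f)
    (by rw [← Matrix.map_mul, hK]; ext; simp)
  rw [map_mul, map_mul, map_pow, map_pow, map_bordered, map_bordered, RingHom.map_det,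
    RingHom.map_det]
  exact h

/-- A family of vectors contains a basis of its span. -/
theorem exists_linearIndependent_comp {n κ F V : Type*} [Finite n] [Fintype κ] [Field F]
    [AddCommGroup V] [Module F V] (v : n → V)
    (hc : Module.finrank F (Submodule.span F (Set.range v)) = Fintype.card κ) :
    ∃ σ : κ → n, LinearIndependent F (v ∘ σ) := by
  obtain ⟨s, hs, hspan, hli⟩ := exists_linearIndependent F (Set.range v)
  have hfin : s.Finite := (Set.finite_range v).subset hs
  have : Fintype s := hfin.fintype
  have hcard : Fintype.card κ = Fintype.card s := by
    rw [← hc, ← hspan, finrank_span_set_eq_card hli, Set.toFinset_card]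
  choose g hg using fun x : s => hs x.2
  refine ⟨g ∘ Fintype.equivOfCardEq hcard, ?_⟩
  have : v ∘ g ∘ Fintype.equivOfCardEq hcard = Subtype.val ∘ Fintype.equivOfCardEq hcard := by
    ext x; exact hg _
  rw [this]
  exact hli.comp _ (Equiv.injective _)

theorem linearIndependent_col_iff_exists_det_ne_zero {n κ F : Type*} [Fintype n] [Fintype κ]
    [DecidableEq κ] [Field F] (K : Matrix n κ F) :
    LinearIndependent F K.col ↔ ∃ σ : κ → n, (K.submatrix σ id).det ≠ 0 := by
  constructor
  · intro h
    have hrank : Kᵀ.rank = Fintype.card κ := LinearIndependent.rank_matrix (M := Kᵀ) h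
    rw [rank_transpose, rank_eq_finrank_span_row] at hrank
    obtain ⟨σ, hσ⟩ := exists_linearIndependent_comp (κ := κ) K.row hrank
    refine ⟨σ, ?_⟩
    have := linearIndependent_rows_iff_isUnit.1
      (show LinearIndependent F (K.submatrix σ id).row from hσ)
    exact ((isUnit_iff_isUnit_det _).1 this).ne_zero
  · rintro ⟨σ, hσ⟩
    have h : LinearIndependent F (K.submatrix σ id).col :=
      linearIndependent_cols_iff_isUnit.2 ((isUnit_iff_isUnit_det _).2 hσ.isUnit)
    exact LinearIndependent.of_comp (LinearMap.funLeft F F σ) h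

/-- The coordinates with indices `σ` are injective on the kernel of `M` if the bordered determinant
does not vanish. -/
theorem finrank_ker_le_of_bordered_ne_zero {F : Type*} [Field F] {M : Matrix n n F} {σ : κ → n}
    (h : bordered M σ ≠ 0) : Module.finrank F (LinearMap.ker M.mulVecLin) ≤ Fintype.card κ := by
  have hinj := mulVec_injective_iff_isUnit.2 ((isUnit_iff_isUnit_det _).2 h.isUnit)
  rw [← Module.finrank_fintype_fun_eq_card (R := F) (η := κ)]
  refine LinearMap.finrank_le_finrank_of_injective
    (f := (LinearMap.funLeft F F σ) ∘ₗ (LinearMap.ker M.mulVecLin).subtype) ?_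
  rw [injective_iff_map_eq_zero]
  rintro ⟨x, hx⟩ h0
  have hx' : M *ᵥ x = 0 := hx
  have h1 : (1 : Matrix n n F).submatrix σ id *ᵥ x = 0 := by
    ext a
    have := congrFun h0 a
    simpa [mulVec, dotProduct, one_apply, LinearMap.funLeft] using this
  have : Sum.elim x (0 : κ → F) = 0 := hinj (by
    change fromBlocks _ _ _ _ *ᵥ _ = fromBlocks _ _ _ _ *ᵥ _
    rw [fromBlocks_mulVec, mulVec_zero]
    simp [hx', h1])
  ext i
  exact congrFun this (Sum.inl i)

/-- The standard basis vectors with indices `σ` are chosen to span a complement of the range of `M`;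
by skew-symmetry they then also separate the points of the kernel. -/
theorem exists_bordered_ne_zero {F : Type*} [Field F] {M : Matrix n n F} (hM : Mᵀ = -M)
    (h : Module.finrank F (LinearMap.ker M.mulVecLin) = Fintype.card κ) :
    ∃ σ : κ → n, bordered M σ ≠ 0 := by
  let W := LinearMap.range M.mulVecLin
  let e : n → (n → F) := fun i => Pi.single i 1
  have hspan : Submodule.span F (Set.range (W.mkQ ∘ e)) = ⊤ := by
    rw [Set.range_comp, Submodule.span_image]
    have : Submodule.span F (Set.range e) = ⊤ := by
      have := (Pi.basisFun F n).span_eq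
      rwa [show ⇑(Pi.basisFun F n) = e by ext i j; simp [e]] at this
    rw [this, Submodule.map_top, Submodule.range_mkQ]
  have hcard : Module.finrank F ((n → F) ⧸ W) = Fintype.card κ := by
    have h1 := W.finrank_quotient_add_finrank
    have h2 := LinearMap.finrank_range_add_finrank_ker M.mulVecLin
    change Module.finrank F W + _ = _ at h2
    omega
  obtain ⟨σ, hσ⟩ := exists_linearIndependent_comp (κ := κ) (W.mkQ ∘ e)
    (by rw [hspan, finrank_top, hcard])
  refine ⟨σ, ?_⟩
  have htop : Submodule.span F (Set.range ((W.mkQ ∘ e) ∘ σ)) = ⊤ :=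
    hσ.span_eq_top_of_card_eq_finrank' hcard.symm
  suffices hinj : Function.Injective (fromBlocks M ((1 : Matrix n n F).submatrix id σ)
      ((1 : Matrix n n F).submatrix σ id) 0).mulVec from
    ((isUnit_iff_isUnit_det _).1 (mulVec_injective_iff_isUnit.1 hinj)).ne_zero
  have hU : ∀ y : κ → F, (1 : Matrix n n F).submatrix id σ *ᵥ y = ∑ a, y a • e (σ a) := by
    intro y
    ext i
    simp [mulVec, dotProduct, one_apply, e, Finset.sum_apply, Pi.single_apply, mul_comm]
  refine (injective_iff_map_eq_zero (Matrix.mulVecLin _)).2 fun z hz => ?_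
  change fromBlocks _ _ _ _ *ᵥ z = 0 at hz
  rw [fromBlocks_mulVec] at hz
  set x := z ∘ Sum.inl
  set y := z ∘ Sum.inr
  have hz1 : M *ᵥ x + ∑ a, y a • e (σ a) = 0 := by
    rw [← hU]; ext i; exact congrFun hz (Sum.inl i)
  have hz2 : ∀ a, x (σ a) = 0 := fun a => by
    have := congrFun hz (Sum.inr a)
    simpa [mulVec, dotProduct, one_apply] using this
  have hy : y = 0 := by
    have h1 := congrArg W.mkQ hz1
    have h2 : W.mkQ (M *ᵥ x) = 0 := (Submodule.Quotient.mk_eq_zero W).2 ⟨x, rfl⟩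
    rw [map_add, map_zero, map_sum, h2, zero_add] at h1
    simp only [map_smul] at h1
    exact funext fun a => Fintype.linearIndependent_iff.1 hσ y h1 a
  have hMx : M *ᵥ x = 0 := by simpa [hy] using hz1
  have hx : x = 0 := by
    -- `x` is orthogonal to the range of `M` and to the chosen basis vectors, which span everything.
    let O : Submodule F (n → F) := LinearMap.ker (dotProductBilin F F x)
    have hO : O = ⊤ := by
      have hW : W ≤ O := by
        rintro _ ⟨u, rfl⟩
        change x ⬝ᵥ (M *ᵥ u) = 0
        rw [dotProduct_mulVec, ← mulVec_transpose, hM, neg_mulVec, hMx]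
        simp
      have hS : Submodule.span F (Set.range (e ∘ σ)) ≤ O := by
        rw [Submodule.span_le]
        rintro _ ⟨a, rfl⟩
        change x ⬝ᵥ e (σ a) = 0
        simpa [e] using hz2 a
      refine top_le_iff.1 (le_trans (le_of_eq ?_) (sup_le hW hS))
      rw [← Submodule.comap_map_mkQ, ← Submodule.span_image, ← Set.range_comp,
        ← Function.comp_assoc, htop, Submodule.comap_top]
    ext i
    have : e i ∈ O := hO ▸ Submodule.mem_top
    have : x ⬝ᵥ e i = 0 := this
    simpa [e] using this
  ext (i | a)
  · exact congrFun hx i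
  · exact congrFun hy a

/-- Some square submatrix of size `M.rank` is nonsingular. -/
theorem exists_submatrix_det_ne_zero {n n' F : Type*} [Fintype n] [Fintype n'] [Field F]
    (M : Matrix n n' F) :
    ∃ (τ : Fin M.rank → n) (σ : Fin M.rank → n'), (M.submatrix τ σ).det ≠ 0 := by
  obtain ⟨σ, hσ⟩ := exists_linearIndependent_comp (κ := Fin M.rank) M.col
    (by rw [Fintype.card_fin, rank_eq_finrank_span_cols])
  obtain ⟨τ, hτ⟩ := (linearIndependent_col_iff_exists_det_ne_zero (M.submatrix id σ)).1 hσ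
  exact ⟨τ, σ, hτ⟩

/-- A matrix factors through a space of dimension equal to its rank. -/
theorem exists_rank_factorization {n n' F : Type*} [Fintype n'] [DecidableEq n']
    [Finite n] [Field F] (M : Matrix n n' F) :
    ∃ (P : Matrix n (Fin M.rank) F) (Q : Matrix (Fin M.rank) n' F), M = P * Q := by
  let w : Module.Basis (Fin M.rank) F (LinearMap.range M.mulVecLin) :=
    Module.finBasis F (LinearMap.range M.mulVecLin)
  refine ⟨of fun i c => (w c : n → F) i,
    of fun c j => w.repr (M.mulVecLin.rangeRestrict (Pi.single j 1)) c, ?_⟩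
  ext i j
  have h := congrArg (fun x : LinearMap.range M.mulVecLin => (x : n → F) i)
    (w.sum_repr (M.mulVecLin.rangeRestrict (Pi.single j 1)))
  simp only [Submodule.coe_sum, Submodule.coe_smul, Finset.sum_apply, Pi.smul_apply,
    smul_eq_mul, LinearMap.codRestrict_apply, LinearMap.rangeRestrict] at h
  simp only [mul_apply, of_apply]
  rw [show M i j = M.mulVecLin (Pi.single j 1) i by simp, ← h]
  exact Finset.sum_congr rfl fun c _ => mul_comm _ _

end LinearAlgebra

/-! ### Homogeneity of determinants -/

section Homogeneous

open MvPolynomial Matrix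

variable {k ι n κ : Type*} [Field k] [Fintype n] [DecidableEq n] [Fintype κ] [DecidableEq κ]

/-- A determinant is homogeneous if the degrees of the nonzero entries are of the form
`u i + v j`. -/
theorem isHomogeneous_det {M : Matrix n n (MvPolynomial ι k)} (u v : n → ℤ)
    (h : ∀ i j, M i j = 0 ∨ ∃ e : ℕ, (M i j).IsHomogeneous e ∧ (e : ℤ) = u i + v j)
    {N : ℕ} (hN : (N : ℤ) = ∑ i, u i + ∑ j, v j) : M.det.IsHomogeneous N := by
  rw [det_apply]
  refine IsHomogeneous.sum _ _ _ fun σ _ => ?_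
  suffices hp : (∏ i, M (σ i) i).IsHomogeneous N by
    rcases Int.units_eq_one_or (Equiv.Perm.sign σ) with hs | hs
    · simpa [hs] using hp
    · simpa [hs] using hp.neg
  by_cases h0 : ∃ i, M (σ i) i = 0
  · obtain ⟨i, hi⟩ := h0
    have h1 : ∏ i, M (σ i) i = 0 := Finset.prod_eq_zero (Finset.mem_univ i) hi
    rw [h1]
    exact isHomogeneous_zero _ _ _
  · push Not at h0
    choose e he he' using fun i => (h (σ i) i).resolve_left (h0 i)
    have hsum : N = ∑ i, e i := by
      have : (N : ℤ) = ∑ i, (e i : ℤ) := by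
        simp_rw [hN, he', Finset.sum_add_distrib, Equiv.sum_comp σ u]
      exact_mod_cast this
    rw [hsum]
    exact IsHomogeneous.prod _ _ _ fun i _ => he i

theorem isHomogeneous_bordered {M : Matrix n n (MvPolynomial ι k)}
    (h : ∀ i j, (M i j).IsHomogeneous 1) (σ : κ → n) {N : ℕ}
    (hN : N + Fintype.card κ = Fintype.card n) : (bordered M σ).IsHomogeneous N := by
  refine isHomogeneous_det (Sum.elim (fun _ => 1) fun _ => 0) (Sum.elim (fun _ => 0) fun _ => -1)
    ?_ (by simp; omega)
  have h1 : ∀ i j : n, ((1 : Matrix n n (MvPolynomial ι k)) i j).IsHomogeneous 0 := by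
    intro i j
    rw [one_apply]
    split_ifs
    exacts [isHomogeneous_one _ _, isHomogeneous_zero _ _ _]
  rintro (i | i) (j | j)
  · exact .inr ⟨1, h i j, rfl⟩
  · exact .inr ⟨0, h1 _ _, rfl⟩
  · exact .inr ⟨0, h1 _ _, rfl⟩
  · exact .inl rfl

end Homogeneous

/-! ### Families of forms with proportional squares -/

section Codimension

open MvPolynomial

variable {k ι : Type*} [Field k] [IsAlgClosed k] [Finite ι]

/-- A set that contains a hypersurface has codimension at most one. -/
theorem height_vanishingIdeal_le_one {f : MvPolynomial ι k} (hf : Prime f) {Z : Set (ι → k)}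
    (hZ : ∀ x, eval x f = 0 → x ∈ Z) : (vanishingIdeal k Z).height ≤ 1 := by
  have hp : (Ideal.span {f}).IsPrime := (Ideal.span_singleton_prime hf.ne_zero).2 hf
  have hle : vanishingIdeal k Z ≤ Ideal.span {f} := by
    rw [← MvPolynomial.IsPrime.vanishingIdeal_zeroLocus (K := k) (Ideal.span {f})]
    refine vanishingIdeal_anti_mono fun x hx => hZ x ?_
    simpa [coe_aeval_eq_eval] using hx f (Ideal.mem_span_singleton_self f)
  refine (Ideal.height_mono hle).trans ?_
  exact Ideal.height_le_one_of_isPrincipal_of_mem_minimalPrimes (Ideal.span {f}) _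
    (by rw [Ideal.minimalPrimes_eq_subsingleton_self]; rfl)

theorem isUnit_of_forall_prime_dvd {f : MvPolynomial ι k} (hf : f ≠ 0) {Z : Set (ι → k)}
    (h2 : 2 ≤ (vanishingIdeal k Z).height)
    (hZ : ∀ q, Prime q → q ∣ f → ∀ x, eval x q = 0 → x ∈ Z) : IsUnit f := by
  by_contra hu
  obtain ⟨q, hq, hqf⟩ := WfDvdMonoid.exists_irreducible_factor hu hf
  have := h2.trans (height_vanishingIdeal_le_one hq.prime (hZ q hq.prime hqf))
  exact absurd this (by norm_num)

/-- Let two families `P`, `Q` of forms satisfy `P s : P t = Q s ^ 2 : Q t ^ 2`, with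
`deg P = 2 deg Q`. The ratio `P s / Q s ^ 2` is a reduced fraction `α / β`; the family `P` vanishes
on the hypersurface `α = 0` and the family `Q` on `β = 0`. If the common zero set of one of the
families has codimension at least two, then `α` or `β` is constant, hence both are since their
degrees agree, and the two families have the same common zeros. -/
theorem nonvanishing_eq_of_codim {T : Type*} {P Q : T → MvPolynomial ι k} {d : ℕ}
    (hP : ∀ s, (P s).IsHomogeneous (2 * d)) (hQ : ∀ s, (Q s).IsHomogeneous d)
    (hPQ : ∀ s t, P s * Q t ^ 2 = P t * Q s ^ 2) (hP0 : ∃ s, P s ≠ 0) (hQ0 : ∃ s, Q s ≠ 0)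
    (h2 : 2 ≤ (vanishingIdeal k {x | ∃ s, eval x (P s) ≠ 0}ᶜ).height ∨
      2 ≤ (vanishingIdeal k {x | ∃ s, eval x (Q s) ≠ 0}ᶜ).height) :
    {x | ∃ s, eval x (P s) ≠ 0} = {x | ∃ s, eval x (Q s) ≠ 0} := by
  obtain ⟨t, ht⟩ := hQ0
  have ht2 := pow_ne_zero 2 ht
  have htP : P t ≠ 0 := by
    obtain ⟨s, hs⟩ := hP0
    exact left_ne_zero_of_mul (hPQ s t ▸ mul_ne_zero hs ht2)
  obtain ⟨α, β, g, hrel, hα, hβ⟩ :=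
    UniqueFactorizationMonoid.exists_reduced_factors (P t) htP (Q t ^ 2)
  have hg : g ≠ 0 := left_ne_zero_of_mul (hα ▸ htP)
  have hα0 : α ≠ 0 := right_ne_zero_of_mul (hα ▸ htP)
  have hβ0 : β ≠ 0 := right_ne_zero_of_mul (hβ ▸ ht2)
  have hαβ : ∀ s, β * P s = α * Q s ^ 2 := fun s => by
    refine mul_left_cancel₀ hg ?_
    rw [← mul_assoc, ← mul_assoc, hα, hβ, mul_comm, hPQ]
  have hdeg : α.totalDegree = β.totalDegree := by
    have h1 := congrArg totalDegree hα
    have h2 := congrArg totalDegree hβ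
    rw [totalDegree_mul_of_isDomain hg hα0, (hP t).totalDegree htP] at h1
    rw [totalDegree_mul_of_isDomain hg hβ0, ((hQ t).pow 2).totalDegree ht2] at h2
    omega
  have hdeg0 : α.totalDegree = 0 := by
    rcases h2 with h2 | h2
    · refine (isUnit_iff_totalDegree_of_isReduced.1
        (isUnit_of_forall_prime_dvd hα0 h2 fun q _ hqα x hx => ?_)).2
      rintro ⟨s, hs⟩
      have : q ∣ P s := hqα.trans (hrel.dvd_of_dvd_mul_left ⟨_, hαβ s⟩)
      exact hs (zero_dvd_iff.1 (hx ▸ map_dvd (eval x) this))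
    · rw [hdeg]
      refine (isUnit_iff_totalDegree_of_isReduced.1
        (isUnit_of_forall_prime_dvd hβ0 h2 fun q hq hqβ x hx => ?_)).2
      rintro ⟨s, hs⟩
      have : q ∣ Q s := hq.dvd_of_dvd_pow
        (hqβ.trans (hrel.symm.dvd_of_dvd_mul_left ⟨_, (hαβ s).symm⟩))
      exact hs (zero_dvd_iff.1 (hx ▸ map_dvd (eval x) this))
  obtain ⟨a, rfl⟩ : ∃ a, α = C a := ⟨_, totalDegree_eq_zero_iff_eq_C.1 hdeg0⟩
  obtain ⟨c, rfl⟩ : ∃ c, β = C c := ⟨_, totalDegree_eq_zero_iff_eq_C.1 (hdeg ▸ hdeg0)⟩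
  have ha : a ≠ 0 := fun h => hα0 (by rw [h, C_0])
  have hc : c ≠ 0 := fun h => hβ0 (by rw [h, C_0])
  ext x
  refine exists_congr fun s => not_congr ?_
  have h := congrArg (eval x) (hαβ s)
  simp only [map_mul, eval_C, map_pow] at h
  constructor
  · intro h0
    rw [h0, mul_zero] at h
    exact pow_eq_zero_iff two_ne_zero |>.1 ((mul_eq_zero.1 h.symm).resolve_left ha)
  · intro h0
    rw [h0, zero_pow two_ne_zero, mul_zero] at h
    exact (mul_eq_zero.1 h).resolve_left hc

end Codimension

/-! ### The convolution algebra and left-invariant derivations -/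

section Convolution

open WithConv Coalgebra

variable {k A T T' : Type*} [Field k] [CommRing A] [CommRing T] [Algebra k T] [CommRing T']
  [Algebra k T']

/-- `E` is a derivation with respect to the module structure defined by the homomorphism `β`. -/
def IsDerivationAlong [Algebra k A] (β : A →ₐ[k] T) (E : A →ₗ[k] T) : Prop :=
  ∀ a b, E (a * b) = β a * E b + β b * E a

/-- Postcomposition with a homomorphism of algebras, on the convolution algebra. -/
def convComp [Algebra k A] (φ : T →ₗ[k] T') (u : WithConv (A →ₗ[k] T)) : WithConv (A →ₗ[k] T') :=
  toConv (φ ∘ₗ u.ofConv)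

section Bialgebra

variable [Bialgebra k A]

/-- A linear functional on the coordinate ring, as a linear map to an algebra. -/
def convConst (T : Type*) [CommRing T] [Algebra k T] (d : WithConv (A →ₗ[k] k)) :
    WithConv (A →ₗ[k] T) :=
  convComp (Algebra.linearMap k T) d

theorem convComp_mul (φ : T →ₐ[k] T') (u v : WithConv (A →ₗ[k] T)) :
    convComp φ.toLinearMap (u * v) = convComp φ.toLinearMap u * convComp φ.toLinearMap v :=
  congrArg toConv (LinearMap.algHom_comp_convMul_distrib φ u v)

theorem convConst_mul (d e : WithConv (A →ₗ[k] k)) :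
    convConst T (d * e) = convConst T d * convConst T e :=
  convComp_mul (Algebra.ofId k T) d e

theorem convComp_convConst (φ : T →ₐ[k] T') (d : WithConv (A →ₗ[k] k)) :
    convComp φ.toLinearMap (convConst T d) = convConst T' d := by
  ext a
  exact φ.commutes _

theorem convConst_self (d : WithConv (A →ₗ[k] k)) : convConst k d = d := rfl

theorem convComp_one (φ : T →ₐ[k] T') :
    convComp φ.toLinearMap (1 : WithConv (A →ₗ[k] T)) = 1 := by
  ext a
  exact φ.commutes _

/-- The Leibniz rule for a derivation applied to a convolution product. -/
theorem IsDerivationAlong.convComp_mul {β : T →ₐ[k] T'} {E : T →ₗ[k] T'}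
    (hE : IsDerivationAlong β E) (u v : WithConv (A →ₗ[k] T)) :
    convComp E (u * v) =
      convComp E u * convComp β.toLinearMap v + convComp β.toLinearMap u * convComp E v := by
  ext a
  change E (LinearMap.mul' k T (TensorProduct.map u.ofConv v.ofConv (comul a))) =
    LinearMap.mul' k T' (TensorProduct.map (E ∘ₗ u.ofConv) (β.toLinearMap ∘ₗ v.ofConv) (comul a)) +
    LinearMap.mul' k T' (TensorProduct.map (β.toLinearMap ∘ₗ u.ofConv) (E ∘ₗ v.ofConv) (comul a))
  generalize (comul (R := k) a) = t
  induction t with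
  | zero => simp
  | add x y hx hy => simp only [map_add, hx, hy]; ring
  | tmul x y =>
    simp only [TensorProduct.map_tmul, LinearMap.mul'_apply, LinearMap.comp_apply,
      AlgHom.toLinearMap_apply]
    rw [hE]
    ring

/-- Left translation of a derivation by a point with values in `T`. -/
theorem IsDerivationAlong.mul_left {β : A →ₐ[k] T} {E : A →ₗ[k] T}
    (hE : IsDerivationAlong β E) (α : A →ₐ[k] T) :
    IsDerivationAlong (toConv α * toConv β).ofConv (toConv α.toLinearMap * toConv E).ofConv := by
  intro a b
  change LinearMap.mul' k T (TensorProduct.map α.toLinearMap E (comul (a * b))) =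
    (toConv α * toConv β) a *
      LinearMap.mul' k T (TensorProduct.map α.toLinearMap E (comul b)) +
    (toConv α * toConv β) b *
      LinearMap.mul' k T (TensorProduct.map α.toLinearMap E (comul a))
  rw [AlgHom.convMul_apply, AlgHom.convMul_apply, Bialgebra.comul_mul]
  generalize (comul (R := k) a) = t
  generalize (comul (R := k) b) = t'
  induction t with
  | zero => simp
  | add x y hx hy => simp only [add_mul, map_add, hx, hy]; ring
  | tmul x y =>
    induction t' with
    | zero => simp
    | add x y hx hy => simp only [mul_add, map_add, hx, hy]; ring
    | tmul x' y' =>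
      simp only [Algebra.TensorProduct.tmul_mul_tmul, TensorProduct.map_tmul,
        LinearMap.mul'_apply, AlgHom.toLinearMap_apply, map_mul, Algebra.TensorProduct.lift_tmul]
      rw [hE]
      ring

/-- Right translation of a derivation by a point with values in `T`. -/
theorem IsDerivationAlong.mul_right {β : A →ₐ[k] T} {E : A →ₗ[k] T}
    (hE : IsDerivationAlong β E) (α : A →ₐ[k] T) :
    IsDerivationAlong (toConv β * toConv α).ofConv (toConv E * toConv α.toLinearMap).ofConv := by
  intro a b
  change LinearMap.mul' k T (TensorProduct.map E α.toLinearMap (comul (a * b))) =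
    (toConv β * toConv α) a *
      LinearMap.mul' k T (TensorProduct.map E α.toLinearMap (comul b)) +
    (toConv β * toConv α) b *
      LinearMap.mul' k T (TensorProduct.map E α.toLinearMap (comul a))
  rw [AlgHom.convMul_apply, AlgHom.convMul_apply, Bialgebra.comul_mul]
  generalize (comul (R := k) a) = t
  generalize (comul (R := k) b) = t'
  induction t with
  | zero => simp
  | add x y hx hy => simp only [add_mul, map_add, hx, hy]; ring
  | tmul x y =>
    induction t' with
    | zero => simp
    | add x y hx hy => simp only [mul_add, map_add, hx, hy]; ring
    | tmul x' y' =>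
      simp only [Algebra.TensorProduct.tmul_mul_tmul, TensorProduct.map_tmul,
        LinearMap.mul'_apply, AlgHom.toLinearMap_apply, map_mul, Algebra.TensorProduct.lift_tmul]
      rw [hE]
      ring

end Bialgebra

section Hopf

variable [HopfAlgebra k A]

/-- The value at the identity of a left-invariant derivation, as a linear functional on the
coordinate ring. -/
def tangent : lieAlg k A →ₗ[k] Module.Dual k A where
  toFun D := counit ∘ₗ ((D : Derivation k A A) : A →ₗ[k] A)
  map_add' D E := by ext a; simp
  map_smul' r D := by ext a; simp

theorem tangent_apply (D : lieAlg k A) (a : A) :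
    tangent D a = counit (R := k) ((D : Derivation k A A) a) := rfl

theorem id_mul_convConst_apply (d : WithConv (A →ₗ[k] k)) (a : A) :
    (toConv (LinearMap.id (M := A)) * convConst A d : WithConv (A →ₗ[k] A)) a =
      TensorProduct.rid k A (d.ofConv.lTensor A (comul a)) := by
  change LinearMap.mul' k A (TensorProduct.map _ _ (comul a)) = _
  generalize (comul (R := k) a) = t
  induction t with
  | zero => simp
  | add x y hx hy => simp only [map_add, hx, hy]
  | tmul x y => simp [convConst, convComp, Algebra.smul_def, mul_comm]

/-- A left-invariant derivation is determined by its value at the identity. -/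
theorem toConv_eq_id_mul_tangent (D : lieAlg k A) :
    toConv ((D : Derivation k A A) : A →ₗ[k] A) =
      toConv LinearMap.id * convConst A (toConv (tangent D)) := by
  ext a
  rw [id_mul_convConst_apply]
  have hD : comul (R := k) ((D : Derivation k A A) a) =
    ((D : Derivation k A A) : A →ₗ[k] A).lTensor A (comul a) := D.2 a
  have h := lTensor_counit_comul (R := k) ((D : Derivation k A A) a)
  rw [hD, ← LinearMap.comp_apply, ← LinearMap.lTensor_comp] at h
  change _ = TensorProduct.rid k A ((counit ∘ₗ _).lTensor A (comul a))
  rw [h]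
  simp

theorem tangent_injective : Function.Injective (tangent : lieAlg k A →ₗ[k] Module.Dual k A) := by
  intro D E h
  have h1 := toConv_eq_id_mul_tangent D
  rw [h, ← toConv_eq_id_mul_tangent E] at h1
  ext a
  exact congrArg (fun u : WithConv (A →ₗ[k] A) => u.ofConv a) h1

theorem isDerivationAlong_id (D : Derivation k A A) :
    IsDerivationAlong (AlgHom.id k A) (D : A →ₗ[k] A) := fun a b => by simp

theorem isDerivationAlong_tangent (D : lieAlg k A) :
    IsDerivationAlong (Bialgebra.counitAlgHom k A) (tangent D) := fun a b => by
  simp [tangent_apply]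

theorem IsDerivationAlong.convConst {d : A →ₗ[k] k}
    (hd : IsDerivationAlong (Bialgebra.counitAlgHom k A) d) :
    IsDerivationAlong (1 : WithConv (A →ₐ[k] T)).ofConv (convConst T (toConv d)).ofConv := by
  intro a b
  change algebraMap k T (d (a * b)) = _
  rw [hd, map_add, map_mul, map_mul]
  rfl

/-- Every tangent vector at the identity extends to a left-invariant derivation. -/
theorem exists_tangent_eq {d : A →ₗ[k] k}
    (hd : IsDerivationAlong (Bialgebra.counitAlgHom k A) d) : ∃ D : lieAlg k A, tangent D = d := by
  have h1 := (hd.convConst (T := A)).mul_left (AlgHom.id k A)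
  rw [toConv_ofConv, mul_one] at h1
  let u : WithConv (A →ₗ[k] A) := toConv LinearMap.id * AlgGroup.convConst A (toConv d)
  have hu : ∀ a, u a = TensorProduct.rid k A (d.lTensor A (comul a)) :=
    id_mul_convConst_apply (toConv d)
  refine ⟨⟨Derivation.mk' u.ofConv fun a b => h1 a b, fun f => ?_⟩, ?_⟩
  · have h2 : ∀ t : A ⊗[k] A, comul (R := k) (TensorProduct.rid k A (d.lTensor A t)) =
        ((TensorProduct.rid k A).toLinearMap ∘ₗ d.lTensor A).lTensor A
          (TensorProduct.assoc k A A A (comul.rTensor A t)) := by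
      intro t
      induction t with
      | zero => simp
      | add x y hx hy => simp only [map_add, hx, hy]
      | tmul x y =>
        simp only [LinearMap.lTensor_tmul, TensorProduct.rid_tmul, map_smul, LinearMap.rTensor_tmul]
        generalize (comul (R := k) x) = v
        induction v with
        | zero => simp
        | add x y hx hy => simp only [smul_add, TensorProduct.add_tmul, map_add, hx, hy]
        | tmul v w => simp [TensorProduct.tmul_smul]
    change comul (R := k) (u f) = u.ofConv.lTensor A (comul f)
    rw [hu, h2, coassoc_apply, ← LinearMap.comp_apply, ← LinearMap.lTensor_comp]
    congr 2
    ext a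
    exact (hu a).symm
  · have h3 : convComp (Bialgebra.counitAlgHom k A).toLinearMap u = toConv d := by
      rw [AlgGroup.convComp_mul, convComp_convConst, convConst_self]
      exact one_mul (toConv d)
    exact congrArg ofConv h3

theorem toConv_tangent_lie (D E : lieAlg k A) :
    toConv (tangent ⁅D, E⁆) = toConv (tangent D) * toConv (tangent E) -
      toConv (tangent E) * toConv (tangent D) := by
  have h : ∀ D E : lieAlg k A, toConv (tangent D) * toConv (tangent E) =
      convComp (tangent D) (toConv ((E : Derivation k A A) : A →ₗ[k] A)) := by
    intro D E
    rw [toConv_eq_id_mul_tangent E, (isDerivationAlong_tangent D).convComp_mul, convComp_convConst,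
      convConst_self]
    have h0 : convComp (tangent D) (convConst A (toConv (tangent E))) = 0 := by
      ext a
      change counit (R := k) ((D : Derivation k A A) (algebraMap k A _)) = 0
      rw [Derivation.map_algebraMap, map_zero]
    rw [h0, mul_zero, add_zero]
    rfl
  rw [h, h]
  ext a
  change counit (R := k) (⁅(D : Derivation k A A), (E : Derivation k A A)⁆ a) = _
  rw [Derivation.commutator_apply, map_sub]
  rfl

/-- The map `g ↦ Ad(g⁻¹) d`, for a tangent vector `d` at the identity, encoded as the linear map
that sends a function `f` to the function `g ↦ (Ad(g⁻¹) d) f` on the group. -/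
def adCoeff (d : WithConv (A →ₗ[k] k)) : WithConv (A →ₗ[k] A) :=
  toConv (HopfAlgebra.antipode k) * convConst A d * toConv LinearMap.id

theorem isDerivationAlong_adCoeff (D : lieAlg k A) :
    IsDerivationAlong (1 : WithConv (A →ₐ[k] A)).ofConv (adCoeff (toConv (tangent D))).ofConv := by
  have h := (((isDerivationAlong_tangent D).convConst (T := A)).mul_left
    (HopfAlgebra.antipodeAlgHom k A)).mul_right (AlgHom.id k A)
  have h1 : toConv (HopfAlgebra.antipodeAlgHom k A) = (toConv (AlgHom.id k A))⁻¹ := rfl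
  rwa [toConv_ofConv, toConv_ofConv, mul_one, h1, inv_mul_cancel] at h

theorem counit_comp_adCoeff (d : WithConv (A →ₗ[k] k)) :
    convComp (Bialgebra.counitAlgHom k A).toLinearMap (adCoeff d) = d := by
  rw [adCoeff, convComp_mul, convComp_mul, convComp_convConst, convConst_self]
  have h1 : convComp (Bialgebra.counitAlgHom k A).toLinearMap
      (toConv (HopfAlgebra.antipode k (A := A))) = 1 := by
    ext a
    exact HopfAlgebra.counit_antipode a
  rw [h1, one_mul]
  exact mul_one d

/-- The derivative of `g ↦ Ad(g⁻¹) d` along a left-invariant derivation is a commutator. -/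
theorem derivation_comp_adCoeff (D : lieAlg k A) (d : WithConv (A →ₗ[k] k)) :
    convComp ((D : Derivation k A A) : A →ₗ[k] A) (adCoeff d) =
      adCoeff d * convConst A (toConv (tangent D)) -
        convConst A (toConv (tangent D)) * adCoeff d := by
  have leib := (isDerivationAlong_id (D : Derivation k A A)).convComp_mul (A := A)
  have hid : ∀ u : WithConv (A →ₗ[k] A), convComp (AlgHom.id k A).toLinearMap u = u := fun _ => rfl
  simp only [hid] at leib
  set η := convConst A (toConv (tangent D))
  set S : WithConv (A →ₗ[k] A) := toConv (HopfAlgebra.antipode k)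
  set I : WithConv (A →ₗ[k] A) := toConv LinearMap.id
  have hSI : S * I = 1 := LinearMap.antipode_mul_id
  have hIS : I * S = 1 := LinearMap.id_mul_antipode
  have hDI : convComp ((D : Derivation k A A) : A →ₗ[k] A) I = I * η := toConv_eq_id_mul_tangent D
  have hconst : ∀ e : WithConv (A →ₗ[k] k),
      convComp ((D : Derivation k A A) : A →ₗ[k] A) (convConst A e) = 0 := by
    intro e
    ext a
    exact Derivation.map_algebraMap _ _
  have hDS : convComp ((D : Derivation k A A) : A →ₗ[k] A) S = -(η * S) := by
    have h := leib S I
    have h1 : convComp ((D : Derivation k A A) : A →ₗ[k] A) (1 : WithConv (A →ₗ[k] A)) = 0 := by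
      ext a
      exact Derivation.map_algebraMap _ _
    rw [hSI, h1, hDI, ← mul_assoc, hSI, one_mul] at h
    have h2 := congrArg (· * S) h
    simp only [zero_mul, add_mul, mul_assoc, hIS, mul_one] at h2
    exact eq_neg_of_add_eq_zero_left h2.symm
  rw [adCoeff, leib, leib, hDI, hDS, hconst]
  noncomm_ring

theorem toConv_tangent_Ad (g : Points k A) (D : lieAlg k A) :
    (toConv (tangent (Ad g D)) : WithConv (A →ₗ[k] k)) =
      toConv g.ofConv.toLinearMap * toConv (tangent D) * toConv (g⁻¹).ofConv.toLinearMap := by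
  have hρ : ∀ h : Points k A, toConv (rightTranslation h).toLinearMap =
      toConv LinearMap.id * convConst A (toConv h.ofConv.toLinearMap) := by
    intro h
    ext a
    rw [id_mul_convConst_apply]
    rfl
  have hε : (Bialgebra.counitAlgHom k A).toLinearMap ∘ₗ (rightTranslation g).toLinearMap =
      g.ofConv.toLinearMap := by
    have : convComp (Bialgebra.counitAlgHom k A).toLinearMap
        (toConv (rightTranslation g).toLinearMap) = toConv g.ofConv.toLinearMap := by
      rw [hρ, convComp_mul, convComp_convConst, convConst_self]
      exact one_mul _
    exact congrArg ofConv this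
  have h1 : toConv (tangent (Ad g D)) = convComp g.ofConv.toLinearMap
      (convComp ((D : Derivation k A A) : A →ₗ[k] A)
        (toConv (rightTranslation g⁻¹).toLinearMap)) := by
    rw [← hε]
    rfl
  have h2 : convComp ((D : Derivation k A A) : A →ₗ[k] A)
      (convConst A (toConv (g⁻¹).ofConv.toLinearMap)) = 0 := by
    ext a
    exact Derivation.map_algebraMap _ _
  rw [h1, hρ, (isDerivationAlong_id (D : Derivation k A A)).convComp_mul, h2, mul_zero, add_zero]
  have h3 : convComp ((D : Derivation k A A) : A →ₗ[k] A) (toConv LinearMap.id) = _ :=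
    toConv_eq_id_mul_tangent D
  have h4 : ∀ u : WithConv (A →ₗ[k] A), convComp (AlgHom.id k A).toLinearMap u = u := fun _ => rfl
  rw [h3, h4, convComp_mul, convComp_mul, convComp_convConst, convComp_convConst, convConst_self,
    convConst_self]
  rfl

theorem point_comp_adCoeff (g : Points k A) (D : lieAlg k A) :
    convComp g.ofConv.toLinearMap (adCoeff (toConv (tangent D))) =
      toConv (tangent (Ad g⁻¹ D)) := by
  rw [toConv_tangent_Ad, inv_inv, adCoeff, convComp_mul, convComp_mul, convComp_convConst,
    convConst_self]
  rfl

end Hopf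

end Convolution

/-! ### Polynomial expressions in an algebra -/

section PolynomialMaps

open MvPolynomial

/-- The chain rule for a derivation applied to a polynomial expression. -/
theorem derivation_aeval {k A M ι : Type*} [CommRing k] [CommRing A] [Algebra k A] [AddCommGroup M]
    [Module A M] [Module k M] [Fintype ι] (D : Derivation k A M) (f : ι → A)
    (P : MvPolynomial ι k) : D (aeval f P) = ∑ i, aeval f (pderiv i P) • D (f i) := by
  classical
  induction P using MvPolynomial.induction_on with
  | C a => simp
  | add p q hp hq => simp only [map_add, hp, hq, add_smul, Finset.sum_add_distrib]
  | mul_X p j hp =>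
    simp only [map_mul, aeval_X, Derivation.leibniz, hp, pderiv_X, map_add, add_smul, smul_eq_mul,
      Finset.sum_add_distrib, Finset.smul_sum, mul_smul]
    congr 1
    rw [Finset.sum_eq_single j (fun i _ h => by rw [Pi.single_eq_of_ne' h]; simp) (by simp)]
    simp

theorem totalDegree_pderiv_lt {k ι : Type*} [CommRing k] {P : MvPolynomial ι k} {i : ι}
    (h : pderiv i P ≠ 0) : (pderiv i P).totalDegree < P.totalDegree := by
  obtain ⟨s, hs, hd⟩ := Finset.exists_mem_eq_sup _ (support_nonempty.2 h)
    fun s : ι →₀ ℕ => s.sum fun _ e => e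
  change totalDegree _ = _ at hd
  rw [hd]
  have hs' : s + Finsupp.single i 1 ∈ P.support := by
    rw [mem_support_iff, coeff_pderiv] at hs
    exact mem_support_iff.2 (left_ne_zero_of_mul hs)
  refine lt_of_lt_of_le ?_ (le_totalDegree hs')
  rw [Finsupp.sum_add_index' (fun _ => rfl) (fun _ _ _ => rfl), Finsupp.sum_single_index rfl]
  exact Nat.lt_succ_self _

/-- Jacobian criterion for algebraic independence over a possibly non-integral algebra: it is
enough that a Jacobian determinant does not vanish at one point `e`. A nontrivial relation `P` of
least degree that holds near `e` would give the relations `∂P/∂xᵢ` by Cramer's rule. -/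
theorem algebraicIndependent_of_jacobian {k A σ : Type*} [Field k] [CharZero k] [CommRing A]
    [Algebra k A] [Fintype σ] [DecidableEq σ] (f : σ → A) (D : σ → Derivation k A A)
    (e : A →ₐ[k] k) (he : e (Matrix.of fun t i => D t (f i)).det ≠ 0) :
    AlgebraicIndependent k f := by
  set J : Matrix σ σ A := Matrix.of fun t i => D t (f i)
  have key : ∀ n, ∀ P : MvPolynomial σ k, P.totalDegree < n →
      ∀ N, J.det ^ N * aeval f P = 0 → P = 0 := by
    intro n
    induction n with
    | zero => intro P hP; exact absurd hP (Nat.not_lt_zero _)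
    | succ n ih =>
      intro P hP N h
      have h1 : ∀ t, J.det ^ (N + 1) * D t (aeval f P) = 0 := by
        intro t
        have h2 : D t (J.det ^ (N + 1) * aeval f P) = 0 := by
          rw [pow_succ', mul_assoc, h, mul_zero, map_zero]
        rw [Derivation.leibniz, Derivation.leibniz_pow, smul_eq_mul, smul_eq_mul] at h2
        have h3 : aeval f P * ((N + 1) • J.det ^ (N + 1 - 1) • D t J.det) = 0 := by
          rw [Nat.add_sub_cancel, mul_smul_comm, smul_eq_mul, ← mul_assoc, mul_comm (aeval f P), h,
            zero_mul, smul_zero]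
        rwa [h3, add_zero] at h2
      have h4 : J.mulVec (fun i => J.det ^ (N + 1) * aeval f (pderiv i P)) = 0 := by
        ext t
        rw [Pi.zero_apply, ← h1 t, derivation_aeval, Finset.mul_sum]
        refine Finset.sum_congr rfl fun i _ => ?_
        simp only [J, Matrix.of_apply, smul_eq_mul]
        ring
      have h5 : ∀ i, pderiv i P = 0 := by
        intro i
        by_contra hne
        refine hne (ih _ (lt_of_lt_of_le (totalDegree_pderiv_lt hne) (Nat.lt_succ_iff.1 hP))
          (N + 2) ?_)
        have h6 := congrArg (J.adjugate.mulVec) h4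
        rw [Matrix.mulVec_mulVec, Matrix.adjugate_mul, Matrix.smul_mulVec, Matrix.one_mulVec,
          Matrix.mulVec_zero] at h6
        have h7 := congrFun h6 i
        rw [Pi.smul_apply, smul_eq_mul, Pi.zero_apply, ← mul_assoc, ← pow_succ'] at h7
        exact h7
      rw [eq_C_of_pderiv_eq_zero h5, aeval_C] at h
      have h8 := congrArg e h
      rw [map_mul, map_pow, AlgHom.commutes, map_zero, Algebra.algebraMap_self, RingHom.id_apply]
        at h8
      rw [eq_C_of_pderiv_eq_zero h5, (mul_eq_zero.1 h8).resolve_left (pow_ne_zero _ he), C_0]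
  exact algebraicIndependent_iff.2 fun P hP => key _ P (Nat.lt_succ_self _) 0 (by simpa using hP)

/-- A reduced algebra of finite type over an algebraically closed field embeds into the functions on
its points. -/
theorem eq_zero_of_forall_point_eq_zero {k A : Type*} [Field k] [IsAlgClosed k] [CommRing A]
    [Algebra k A] [Algebra.FiniteType k A] [IsReduced A] {f : A}
    (h : ∀ g : A →ₐ[k] k, g f = 0) : f = 0 := by
  have : IsJacobsonRing A := isJacobsonRing_of_finiteType (A := k)
  have hj : (⊥ : Ideal A).jacobson = ⊥ := IsJacobsonRing.out inferInstance Ideal.isRadical_bot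
  rw [← Ideal.mem_bot, ← hj]
  refine Ideal.mem_sInf.2 fun {I} hI => ?_
  have := hI.2
  let _ := Ideal.Quotient.field I
  have : Algebra.FiniteType k (A ⧸ I) := .of_surjective (Ideal.Quotient.mkₐ k I)
    Ideal.Quotient.mk_surjective
  have : Module.Finite k (A ⧸ I) := finite_of_finite_type_of_isJacobsonRing k (A ⧸ I)
  let e : k ≃ₐ[k] A ⧸ I := AlgEquiv.ofBijective (Algebra.ofId k (A ⧸ I))
    IsAlgClosed.algebraMap_bijective_of_isIntegral
  have h1 : e.symm (Ideal.Quotient.mkₐ k I f) = 0 :=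
    h (e.symm.toAlgHom.comp (Ideal.Quotient.mkₐ k I))
  rw [map_eq_zero_iff _ e.symm.injective] at h1
  exact Ideal.Quotient.eq_zero_iff_mem.1 h1

end PolynomialMaps

/-! ### Coordinates of the coadjoint orbit map -/

section OrbitMap

open WithConv Coalgebra

variable {k A ι : Type*} [Field k] [CommRing A] [HopfAlgebra k A] [Fintype ι]
  (b : Module.Basis ι k (lieAlg k A))

/-- The coordinates on the Lie algebra are evaluations of tangent vectors at functions. -/
theorem exists_dual_functions : ∃ a : ι → A, ∀ D i, tangent D (a i) = b.repr D i := by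
  have : FiniteDimensional k (lieAlg k A) := b.finiteDimensional_of_finite
  have h : Function.Surjective (tangent (k := k) (A := A)).flip :=
    LinearMap.flip_surjective_iff₁.2 tangent_injective
  choose a ha using fun i => h (b.coord i)
  exact ⟨a, fun D i => congrArg (fun u : Module.Dual k (lieAlg k A) => u D) (ha i)⟩

variable {b} {a : ι → A}

/-- A tangent vector at the identity with values in `T` is a combination of the tangent vectors of
the basis. -/
theorem IsDerivationAlong.eq_sum_tangent (ha : ∀ D i, tangent D (a i) = b.repr D i)
    {T : Type*} [CommRing T] [Algebra k T] {e : A →ₗ[k] T}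
    (he : IsDerivationAlong (1 : WithConv (A →ₐ[k] T)).ofConv e) (f : A) :
    e f = ∑ j, e (a j) * algebraMap k T (tangent (b j) f) := by
  -- Linear functionals on `T` reduce the claim to tangent vectors with values in `k`.
  rw [← sub_eq_zero, ← Module.forall_dual_apply_eq_zero_iff k]
  intro φ
  have hd : IsDerivationAlong (Bialgebra.counitAlgHom k A) (φ ∘ₗ e) := by
    intro x y
    change φ (e (x * y)) = _
    rw [he]
    change φ (algebraMap k T (counit x) * e y + algebraMap k T (counit y) * e x) = _
    rw [← Algebra.smul_def, ← Algebra.smul_def, map_add, map_smul, map_smul]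
    rfl
  obtain ⟨D, hD⟩ := exists_tangent_eq hd
  have hrepr : ∀ j, φ (e (a j)) = b.repr D j := fun j => by
    rw [← ha, hD]; rfl
  have h1 : tangent D f = ∑ j, b.repr D j * tangent (b j) f := by
    conv_lhs => rw [← b.sum_repr D, map_sum, LinearMap.sum_apply]
    simp
  rw [map_sub, map_sum, sub_eq_zero]
  change (φ ∘ₗ e) f = _
  rw [← hD, h1]
  refine Finset.sum_congr rfl fun j _ => ?_
  rw [mul_comm (e _), ← Algebra.smul_def, map_smul, hrepr, smul_eq_mul, mul_comm]

/-- Every derivation of the coordinate ring is a combination of left-invariant ones. -/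
theorem exists_derivation_eq_sum (ha : ∀ D i, tangent D (a i) = b.repr D i) {L : Type*}
    [CommRing L] [Algebra k L] [Algebra A L] [IsScalarTower k A L] (E : Derivation k A L) :
    ∃ c : ι → L, ∀ f, E f = ∑ j, c j * algebraMap A L ((b j : Derivation k A A) f) := by
  let π := IsScalarTower.toAlgHom k A L
  have hE : IsDerivationAlong π (E : A →ₗ[k] L) := fun x y => by
    simp [π, Algebra.smul_def]
  -- Translating `E` to the identity gives a tangent vector `e` with values in `L`.
  let S : A →ₐ[k] L := π.comp (HopfAlgebra.antipodeAlgHom k A)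
  have hπS : toConv π.toLinearMap * toConv S.toLinearMap = 1 := by
    have h := convComp_mul (A := A) π (toConv LinearMap.id) (toConv (HopfAlgebra.antipode k))
    rw [LinearMap.id_mul_antipode, convComp_one] at h
    exact h.symm
  have hSπ : toConv S * toConv π = 1 := by
    have h := convComp_mul (A := A) π (toConv (HopfAlgebra.antipode k)) (toConv LinearMap.id)
    rw [LinearMap.antipode_mul_id, convComp_one] at h
    have h1 := (AlgHom.toLinearMap_convMul (toConv S) (toConv π)).trans h.symm
    ext x
    exact congrArg (fun u : WithConv (A →ₗ[k] L) => u.ofConv x) h1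
  have h0 := hE.mul_left S
  rw [hSπ] at h0
  set e : A →ₗ[k] L := (toConv S.toLinearMap * toConv (E : A →ₗ[k] L)).ofConv
  have he : toConv e = ∑ j, e (a j) • convConst L (toConv (tangent (b j))) := by
    ext f
    rw [show toConv e f = e f from rfl, IsDerivationAlong.eq_sum_tangent ha h0 f]
    simp [convConst, convComp]
  have hπe : toConv π.toLinearMap * toConv e = toConv (E : A →ₗ[k] L) := by
    rw [toConv_ofConv, ← mul_assoc, hπS, one_mul]
  refine ⟨fun j => e (a j), fun f => ?_⟩
  have hj : ∀ j, toConv π.toLinearMap * convConst L (toConv (tangent (b j))) =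
      convComp π.toLinearMap (toConv ((b j : Derivation k A A) : A →ₗ[k] A)) := by
    intro j
    rw [toConv_eq_id_mul_tangent, convComp_mul, convComp_convConst]
    rfl
  rw [he, Finset.mul_sum] at hπe
  simp only [mul_smul_comm, hj] at hπe
  have := congrArg (fun u : WithConv (A →ₗ[k] L) => u.ofConv f) hπe
  simpa [convComp, π] using this.symm

variable (b a) in
/-- The functions `g ↦ (g · ξ) (b l)` on the group. Here `a` is a family of functions in which
tangent vectors at the identity have the same coordinates as in the basis `b`. -/
def orbitMap (ξ : Module.Dual k (lieAlg k A)) (l : ι) : A :=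
  ∑ i, ξ (b i) • adCoeff (toConv (tangent (b l))) (a i)

theorem eval_eq_sum (ha : ∀ D i, tangent D (a i) = b.repr D i) (ξ : Module.Dual k (lieAlg k A))
    (D : lieAlg k A) : ξ D = ∑ i, ξ (b i) * tangent D (a i) := by
  conv_lhs => rw [← b.sum_repr D, map_sum]
  exact Finset.sum_congr rfl fun i _ => by rw [map_smul, ha, smul_eq_mul, mul_comm]

theorem point_orbitMap (ha : ∀ D i, tangent D (a i) = b.repr D i) (g : Points k A)
    (ξ : Module.Dual k (lieAlg k A)) (l : ι) :
    g.ofConv (orbitMap b a ξ l) = coords b (coAd g ξ) l := by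
  change _ = ξ (Ad g⁻¹ (b l))
  rw [eval_eq_sum ha, orbitMap, map_sum]
  refine Finset.sum_congr rfl fun i _ => ?_
  rw [map_smul, smul_eq_mul]
  exact congrArg (ξ (b i) * ·) (congrArg (fun u : WithConv (A →ₗ[k] k) => u.ofConv (a i))
    (point_comp_adCoeff g (b l)))

theorem counit_adCoeff (d : WithConv (A →ₗ[k] k)) (f : A) :
    counit (R := k) (adCoeff d f) = d f :=
  congrArg (fun u : WithConv (A →ₗ[k] k) => u.ofConv f) (counit_comp_adCoeff d)

theorem counit_orbitMap (ha : ∀ D i, tangent D (a i) = b.repr D i)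
    (ξ : Module.Dual k (lieAlg k A)) (l : ι) :
    counit (R := k) (orbitMap b a ξ l) = ξ (b l) := by
  rw [eval_eq_sum ha ξ (b l), orbitMap, map_sum]
  refine Finset.sum_congr rfl fun i _ => ?_
  rw [map_smul, counit_adCoeff]
  rfl

/-- The differential of the orbit map, in a left-invariant trivialisation. -/
theorem derivation_orbitMap (ha : ∀ D i, tangent D (a i) = b.repr D i)
    (ξ : Module.Dual k (lieAlg k A)) (D : lieAlg k A) (l : ι) :
    (D : Derivation k A A) (orbitMap b a ξ l) =
      ∑ j, ξ ⁅b j, D⁆ • adCoeff (toConv (tangent (b l))) (a j) := by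
  set c := adCoeff (toConv (tangent (b l)))
  have hc : c = ∑ j, c (a j) • convConst A (toConv (tangent (b j))) := by
    ext f
    have := IsDerivationAlong.eq_sum_tangent ha (isDerivationAlong_adCoeff (b l)) f
    rw [show c f = c.ofConv f from rfl, this]
    simp [convConst, convComp, c]
  have hD : ∀ i, (D : Derivation k A A) (c (a i)) = ∑ j, tangent ⁅b j, D⁆ (a i) • c (a j) := by
    intro i
    have hsub : ∀ d e : WithConv (A →ₗ[k] k),
        convConst A (d - e) = convConst A d - convConst A e := by
      intro d e
      ext f
      exact map_sub (algebraMap k A) _ _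
    have h : convComp ((D : Derivation k A A) : A →ₗ[k] A) c =
        ∑ j, c (a j) • convConst A (toConv (tangent ⁅b j, D⁆)) := by
      rw [derivation_comp_adCoeff D (toConv (tangent (b l)))]
      change c * _ - _ * c = _
      conv_lhs => rw [hc]
      simp only [Finset.sum_mul, Finset.mul_sum, ← Finset.sum_sub_distrib, smul_mul_assoc,
        mul_smul_comm, ← smul_sub, ← convConst_mul, ← hsub, toConv_tangent_lie]
    have h1 := congrArg (fun u : WithConv (A →ₗ[k] A) => u.ofConv (a i)) h
    change (D : Derivation k A A) (c (a i)) = _ at h1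
    rw [h1]
    simp only [convConst, convComp, ofConv_sum, ofConv_smul, LinearMap.sum_apply,
      LinearMap.smul_apply]
    refine Finset.sum_congr rfl fun j _ => ?_
    rw [smul_eq_mul, mul_comm, Algebra.smul_def]
    rfl
  simp only [orbitMap, map_sum, Derivation.map_smul]
  change ∑ i, ξ (b i) • (D : Derivation k A A) (c (a i)) = _
  simp only [hD, Finset.smul_sum]
  rw [Finset.sum_comm]
  refine Finset.sum_congr rfl fun j _ => ?_
  rw [eval_eq_sum ha ξ ⁅b j, D⁆, Finset.sum_smul]
  exact Finset.sum_congr rfl fun i _ => smul_smul _ _ _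

end OrbitMap

/-! ### The Lie–Poisson matrix -/

section LiePoisson

open MvPolynomial Matrix

variable {k L ι : Type*} [Field k] [LieRing L] [LieAlgebra k L] (b : Module.Basis ι k L)

/-- The matrix of the alternating form `(x, y) ↦ ξ ⁅x, y⁆`. -/
def formMatrix (ξ : Module.Dual k L) : Matrix ι ι k := of fun i j => ξ ⁅b i, b j⁆

theorem formMatrix_transpose (ξ : Module.Dual k L) : (formMatrix b ξ)ᵀ = -formMatrix b ξ := by
  ext i j
  change ξ ⁅b j, b i⁆ = -ξ ⁅b i, b j⁆
  rw [← lie_skew, map_neg]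

theorem coords_bijective : Function.Bijective (coords b) :=
  (b.constr k : (ι → k) ≃ₗ[k] _).symm.bijective

theorem codim_compl {Z : Set (Module.Dual k L)} {U : Set (ι → k)}
    (h : ∀ ξ, ξ ∈ Z ↔ coords b ξ ∈ U) : codim b Zᶜ = (vanishingIdeal k Uᶜ).height := by
  have : coords b '' Zᶜ = Uᶜ := by
    rw [Set.image_compl_eq (coords_bijective b), compl_inj_iff]
    rw [show Z = coords b ⁻¹' U from Set.ext h,
      Set.image_preimage_eq _ (coords_bijective b).surjective]
  rw [codim, idealOf, this]

variable [Fintype ι]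

theorem finrank_coadjointStabilizer (ξ : Module.Dual k L) :
    Module.finrank k (coadjointStabilizer ξ) =
      Module.finrank k (LinearMap.ker (formMatrix b ξ).mulVecLin) := by
  have h : (coadjointStabilizer ξ).map b.equivFun.toLinearMap =
      LinearMap.ker (formMatrix b ξ).mulVecLin := by
    ext v
    rw [Submodule.mem_map_equiv, LinearMap.mem_ker]
    set x := b.equivFun.symm v with hx
    have h1 : ∀ i, (formMatrix b ξ *ᵥ v) i = -ξ ⁅x, b i⁆ := by
      intro i
      rw [← map_neg, lie_skew, hx, Module.Basis.equivFun_symm_apply, lie_sum, map_sum]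
      simp only [mulVec, dotProduct, formMatrix, of_apply, lie_smul, map_smul, smul_eq_mul]
      exact Finset.sum_congr rfl fun j _ => mul_comm _ _
    constructor
    · intro h2
      ext i
      rw [mulVecLin_apply, h1, h2 (b i), neg_zero]
      rfl
    · intro h2
      have h3 : ξ ∘ₗ (LieAlgebra.ad k L x : L →ₗ[k] L) = 0 := b.ext fun i => by
        have := congrFun h2 i
        rw [mulVecLin_apply, h1, Pi.zero_apply, neg_eq_zero] at this
        simpa using this
      exact fun y => congrArg (fun u : Module.Dual k L => u y) h3
  rw [← h, LinearEquiv.finrank_map_eq]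

/-- The matrix of Lie–Poisson brackets of the coordinate functions, whose entries are linear
forms on the dual space. -/
def poissonMatrix : Matrix ι ι (MvPolynomial ι k) :=
  of fun i j => ∑ l, C (b.repr ⁅b i, b j⁆ l) * X l

theorem poissonMatrix_map_eval (ξ : Module.Dual k L) :
    (poissonMatrix b).map (eval (coords b ξ)) = formMatrix b ξ := by
  ext i j
  simp only [poissonMatrix, map_apply, of_apply, map_sum, map_mul, eval_C, eval_X, formMatrix]
  conv_rhs => rw [← b.sum_repr ⁅b i, b j⁆, map_sum]
  exact Finset.sum_congr rfl fun l _ => by rw [map_smul, smul_eq_mul]; rfl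

theorem isHomogeneous_poissonMatrix (i j : ι) : (poissonMatrix b i j).IsHomogeneous 1 :=
  IsHomogeneous.sum _ _ _ fun l _ => by
    simpa using (isHomogeneous_C ι (b.repr ⁅b i, b j⁆ l)).mul (isHomogeneous_X k l)

theorem poissonMatrix_transpose : (poissonMatrix b)ᵀ = -poissonMatrix b := by
  ext1 i j
  change ∑ l, C (b.repr ⁅b j, b i⁆ l) * X l = -∑ l, C (b.repr ⁅b i, b j⁆ l) * X l
  rw [← Finset.sum_neg_distrib]
  refine Finset.sum_congr rfl fun l _ => ?_
  rw [← lie_skew, map_neg, Finsupp.neg_apply, map_neg, neg_mul]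

end LiePoisson

/-! ### The Jacobian matrix -/

section Jacobian

open MvPolynomial Matrix

variable {k ι : Type*} [Field k] [Fintype ι] {m : ℕ}

/-- The Jacobian matrix of a family of polynomials. -/
def jacobian (p : Fin m → MvPolynomial ι k) : Matrix ι (Fin m) (MvPolynomial ι k) :=
  of fun i j => pderiv i (p j)

/-- Jacobian criterion: in characteristic zero algebraically independent polynomials have a
nonvanishing maximal Jacobian minor. -/
theorem exists_jacobian_det_ne_zero [CharZero k] {p : Fin m → MvPolynomial ι k}
    (hp : AlgebraicIndependent k p) : ∃ σ : Fin m → ι, ((jacobian p).submatrix σ id).det ≠ 0 := by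
  have hinj := IsFractionRing.injective (MvPolynomial ι k) (FractionRing (MvPolynomial ι k))
  set φ := algebraMap (MvPolynomial ι k) (FractionRing (MvPolynomial ι k)) with hφ
  have hp' : AlgebraicIndependent k (φ ∘ p) :=
    hp.map' (f := IsScalarTower.toAlgHom k _ (FractionRing (MvPolynomial ι k))) hinj
  -- The derivations dual to the family `p` provide a left inverse of the Jacobian matrix.
  choose E hE using fun j : Fin m => exists_derivation_of_algebraicIndependent hp' (Pi.single j 1)
  have hmul : (of fun (j : Fin m) (i : ι) => E j (φ (X i))) * (jacobian p).map φ = 1 := by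
    ext j l
    have h := derivation_aeval ((E j).compAlgebraMap (MvPolynomial ι k)) X (p l)
    simp only [aeval_X_left, AlgHom.id_apply] at h
    have h2 := hE j l
    have h3 : ∀ q, ((E j).compAlgebraMap (MvPolynomial ι k)) q = E j (φ q) := fun _ => rfl
    rw [h3] at h
    simp only [Function.comp_apply] at h2
    rw [h2] at h
    rw [one_apply, mul_apply]
    simp only [h3, Algebra.smul_def] at h
    simp only [of_apply, map_apply, jacobian]
    rw [Pi.single_apply] at h
    simp only [eq_comm (a := l)] at h
    rw [h]
    exact Finset.sum_congr rfl fun i _ => mul_comm _ _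
  have hli : LinearIndependent (FractionRing (MvPolynomial ι k)) ((jacobian p).map φ).col := by
    rw [← mulVec_injective_iff]
    intro v w hvw
    have := congrArg (mulVec (of fun (j : Fin m) (i : ι) => E j (φ (X i)))) hvw
    rwa [mulVec_mulVec, mulVec_mulVec, hmul, one_mulVec, one_mulVec] at this
  obtain ⟨σ, hσ⟩ := (linearIndependent_col_iff_exists_det_ne_zero _).1 hli
  refine ⟨σ, fun h0 => hσ ?_⟩
  have := congrArg φ h0
  rwa [map_zero, RingHom.map_det] at this

theorem isHomogeneous_jacobian_det {k ι : Type*} [Field k] {m : ℕ} {p : Fin m → MvPolynomial ι k}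
    (hp : ∀ j, (p j).IsHomogeneous (p j).totalDegree) (σ : Fin m → ι) {d : ℕ}
    (hd : d + m = ∑ j, (p j).totalDegree) :
    ((jacobian p).submatrix σ id).det.IsHomogeneous d := by
  refine isHomogeneous_det (fun _ => 0) (fun j => (p j).totalDegree - 1) ?_ ?_
  · intro i j
    rcases Nat.eq_zero_or_pos (p j).totalDegree with h | h
    · left
      change pderiv (σ i) (p j) = 0
      rw [totalDegree_eq_zero_iff_eq_C.1 h, pderiv_C]
    · right
      exact ⟨_, (hp j).pderiv, by push_cast [Nat.cast_sub h]; ring⟩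
  · have : (d : ℤ) + m = ∑ j, ((p j).totalDegree : ℤ) := by exact_mod_cast hd
    simp [Finset.sum_sub_distrib]
    linarith

theorem mem_independenceLocus_iff {V : Type*} [AddCommGroup V] [Module k V]
    (b : Module.Basis ι k V) (p : Fin m → MvPolynomial ι k) (ξ : Module.Dual k V) :
    ξ ∈ independenceLocus b p ↔
      ∃ σ : Fin m → ι, eval (coords b ξ) ((jacobian p).submatrix σ id).det ≠ 0 := by
  have h1 : (b.equivFun.toLinearMap ∘ fun j => differential b (p j) ξ) =
      ((jacobian p).map (eval (coords b ξ))).col := by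
    ext j i
    change b.equivFun (∑ i, value b (pderiv i (p j)) ξ • b i) i = _
    rw [← Module.Basis.equivFun_symm_apply, LinearEquiv.apply_symm_apply]
    rfl
  change LinearIndependent k (fun j => differential b (p j) ξ) ↔ _
  rw [← LinearMap.linearIndependent_iff b.equivFun.toLinearMap b.equivFun.ker, h1,
    linearIndependent_col_iff_exists_det_ne_zero]
  refine exists_congr fun σ => ?_
  rw [RingHom.map_det]
  rfl

end Jacobian

/-! ### Dimensions of coadjoint orbits and invariants -/

section Orbits

open MvPolynomial Matrix WithConv

variable {k A ι : Type*} [Field k] [CommRing A] [HopfAlgebra k A] [Fintype ι]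
  {b : Module.Basis ι k (lieAlg k A)} {a : ι → A}

theorem point_aeval_orbitMap (ha : ∀ D i, tangent D (a i) = b.repr D i) (g : Points k A)
    (ξ : Module.Dual k (lieAlg k A)) (P : MvPolynomial ι k) :
    g.ofConv (aeval (orbitMap b a ξ) P) = value b P (coAd g ξ) := by
  rw [← AlgHom.comp_apply, comp_aeval, value, ← aeval_eq_eval]
  congr 2
  exact _root_.funext fun l => point_orbitMap ha g ξ l

theorem counit_aeval_orbitMap (ha : ∀ D i, tangent D (a i) = b.repr D i)
    (ξ : Module.Dual k (lieAlg k A)) (P : MvPolynomial ι k) :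
    Coalgebra.counit (R := k) (aeval (orbitMap b a ξ) P) = value b P ξ := by
  change Bialgebra.counitAlgHom k A _ = _
  rw [← AlgHom.comp_apply, comp_aeval, value, ← aeval_eq_eval]
  congr 2
  exact _root_.funext fun l => counit_orbitMap ha ξ l

theorem counit_derivation_orbitMap (ha : ∀ D i, tangent D (a i) = b.repr D i)
    (ξ : Module.Dual k (lieAlg k A)) (D : lieAlg k A) (l : ι) :
    Coalgebra.counit (R := k) ((D : Derivation k A A) (orbitMap b a ξ l)) = ξ ⁅b l, D⁆ := by
  classical
  rw [derivation_orbitMap ha, map_sum, Finset.sum_eq_single l]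
  · rw [map_smul, counit_adCoeff]
    change _ • tangent (b l) (a l) = _
    simp [ha]
  · intro j _ hj
    rw [map_smul, counit_adCoeff]
    change _ • tangent (b l) (a j) = _
    simp [ha, hj.symm]
  · simp

/-- Algebraically independent functions on the closure of the coadjoint orbit of `ξ` are at most
`rank ξ ⁅·, ·⁆` many, since the differential of the orbit map has this rank everywhere. -/
theorem card_le_rank_formMatrix [CharZero k] (ha : ∀ D i, tangent D (a i) = b.repr D i)
    (ξ : Module.Dual k (lieAlg k A)) {N : ℕ} (G : Fin N → MvPolynomial ι k)
    (hG : AlgebraicIndependent k fun j => aeval (orbitMap b a ξ) (G j)) :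
    N ≤ (formMatrix b ξ).rank := by
  classical
  obtain ⟨L, _, _, _, _, hL⟩ := exists_algebraicIndependent_field hG
  set f := orbitMap b a ξ
  set φ := algebraMap A L
  choose E hE using fun j : Fin N => exists_derivation_of_algebraicIndependent hL (Pi.single j 1)
  choose c hc using fun j : Fin N => exists_derivation_eq_sum ha ((E j).compAlgebraMap A)
  obtain ⟨P, Q, hPQ⟩ := exists_rank_factorization (formMatrix b ξ)
  -- The identity matrix of size `N` factors through a space of dimension `rank ξ ⁅·, ·⁆`.
  let U : Matrix (Fin N) ι L := of c
  let C' : Matrix ι ι L := of fun j i => φ (adCoeff (toConv (tangent (b i))) (a j))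
  let W : Matrix ι (Fin N) L := of fun i j => φ (aeval f (pderiv i (G j)))
  have h1 : U * ((formMatrix b ξ).map (algebraMap k L))ᵀ * C' * W = 1 := by
    ext j l
    have h2 : E j (φ (aeval f (G l))) = (1 : Matrix (Fin N) (Fin N) L) j l := by
      have := hE j l
      rw [Function.comp_apply] at this
      rw [this, Pi.single_apply, one_apply]
      simp only [eq_comm]
    have h3 : E j (φ (aeval f (G l))) = _ := hc j (aeval f (G l))
    rw [← h2, h3, Matrix.mul_assoc, Matrix.mul_assoc, mul_apply]
    refine Finset.sum_congr rfl fun t _ => ?_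
    refine congrArg (c j t * ·) ?_
    rw [← Matrix.mul_assoc, mul_apply, derivation_aeval, map_sum]
    refine Finset.sum_congr rfl fun i _ => ?_
    rw [smul_eq_mul, map_mul, mul_comm, derivation_orbitMap ha, map_sum, mul_apply]
    congr 1
    refine Finset.sum_congr rfl fun s _ => ?_
    rw [Algebra.smul_def, map_mul, ← IsScalarTower.algebraMap_apply]
    rfl
  have h4 : ((formMatrix b ξ).map (algebraMap k L))ᵀ =
      (Q.map (algebraMap k L))ᵀ * (P.map (algebraMap k L))ᵀ := by
    rw [← transpose_mul, ← Matrix.map_mul, ← hPQ]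
  rw [h4, ← Matrix.mul_assoc, Matrix.mul_assoc _ C', Matrix.mul_assoc] at h1
  have h5 := rank_mul_le_left (U * (Q.map (algebraMap k L))ᵀ)
    ((P.map (algebraMap k L))ᵀ * (C' * W))
  rw [h1, rank_one, Fintype.card_fin] at h5
  simpa using h5.trans (rank_le_width _)

variable [IsAlgClosed k] [Algebra.FiniteType k A] [IsReduced A]

theorem mem_idealOf_coadjointOrbit_iff (ha : ∀ D i, tangent D (a i) = b.repr D i)
    (ξ : Module.Dual k (lieAlg k A)) (P : MvPolynomial ι k) :
    P ∈ idealOf b (coadjointOrbit ξ) ↔ aeval (orbitMap b a ξ) P = 0 := by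
  constructor
  · intro h
    refine eq_zero_of_forall_point_eq_zero (k := k) fun g => ?_
    refine (point_aeval_orbitMap ha (toConv g) ξ P).trans ?_
    have := h (coords b (coAd (toConv g) ξ)) ⟨_, ⟨toConv g, rfl⟩, rfl⟩
    exact this
  · rintro h _ ⟨_, ⟨g, rfl⟩, rfl⟩
    have := point_aeval_orbitMap ha g ξ P
    rw [h, map_zero] at this
    exact this.symm

/-- The differential of an invariant polynomial at `ξ` lies in the stabiliser of `ξ`. -/
theorem sum_pderiv_mul_eq_zero_of_mem_invariants {p : MvPolynomial ι k} (hp : p ∈ invariants b)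
    (ξ : Module.Dual k (lieAlg k A)) (D : lieAlg k A) :
    ∑ i, value b (pderiv i p) ξ * ξ ⁅b i, D⁆ = 0 := by
  obtain ⟨a, ha⟩ := exists_dual_functions b
  have h1 : aeval (orbitMap b a ξ) p = algebraMap k A (value b p ξ) := by
    rw [← sub_eq_zero]
    refine eq_zero_of_forall_point_eq_zero (k := k) fun g => ?_
    rw [map_sub, AlgHom.commutes, sub_eq_zero]
    exact (point_aeval_orbitMap ha (toConv g) ξ p).trans (hp (toConv g) ξ)
  have h2 := congrArg (D : Derivation k A A) h1
  rw [Derivation.map_algebraMap, derivation_aeval] at h2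
  have h3 := congrArg (Coalgebra.counit (R := k)) h2
  rw [map_sum, map_zero] at h3
  rw [← h3]
  refine Finset.sum_congr rfl fun i _ => ?_
  rw [smul_eq_mul, Bialgebra.counit_mul, counit_aeval_orbitMap ha, counit_derivation_orbitMap ha]

/-- The dimension of the coadjoint orbit of `ξ` is the rank of the form `ξ ⁅·, ·⁆`. -/
theorem dimension_coadjointOrbit [CharZero k] (b : Module.Basis ι k (lieAlg k A))
    (ξ : Module.Dual k (lieAlg k A)) :
    dimension b (coadjointOrbit ξ) = ((formMatrix b ξ).rank : Cardinal) := by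
  obtain ⟨a, ha⟩ := exists_dual_functions b
  set I := idealOf b (coadjointOrbit ξ) with hI
  let φ : MvPolynomial ι k ⧸ I →ₐ[k] A := Ideal.Quotient.liftₐ I (aeval (orbitMap b a ξ))
    fun P hP => (mem_idealOf_coadjointOrbit_iff ha ξ P).1 hP
  have hφ : Function.Injective φ := by
    refine (injective_iff_map_eq_zero φ).2 fun x hx => ?_
    obtain ⟨P, rfl⟩ := Ideal.Quotient.mk_surjective x
    exact Ideal.Quotient.eq_zero_iff_mem.2 ((mem_idealOf_coadjointOrbit_iff ha ξ P).2 hx)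
  have hφmk : ∀ P, φ (Ideal.Quotient.mkₐ k I P) = aeval (orbitMap b a ξ) P := fun P => rfl
  refine le_antisymm ?_ ?_
  · refine ciSup_le' fun s => Cardinal.card_le_of fun t => ?_
    have h1 := (s.2.comp (fun i : Fin t.card => (t.equivFin.symm i : s.1))
      (Subtype.val_injective.comp t.equivFin.symm.injective)).map' hφ
    choose G hG using fun i : Fin t.card =>
      Ideal.Quotient.mkₐ_surjective k I (t.equivFin.symm i : s.1)
    refine card_le_rank_formMatrix ha ξ G ?_
    convert h1 using 1
    ext i
    rw [← hφmk, hG]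
    rfl
  · obtain ⟨τ, σ, hτσ⟩ := exists_submatrix_det_ne_zero (formMatrix b ξ)
    have h1 : AlgebraicIndependent k fun i => orbitMap b a ξ (τ i) := by
      refine algebraicIndependent_of_jacobian _ (fun t => (b (σ t) : Derivation k A A))
        (Bialgebra.counitAlgHom k A) ?_
      rw [AlgHom.map_det, ← det_transpose]
      convert hτσ using 2
      ext i t
      exact counit_derivation_orbitMap ha ξ (b (σ t)) (τ i)
    have h2 : AlgebraicIndependent k fun i => Ideal.Quotient.mkₐ k I (X (τ i)) := by
      refine (φ.algebraicIndependent_iff hφ).1 ?_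
      convert h1 using 1
      ext i
      exact (hφmk _).trans (aeval_X _ _)
    have h3 := h2.lift_cardinalMk_le_trdeg
    rw [Cardinal.mk_fin, Cardinal.lift_natCast, Cardinal.lift_uzero] at h3
    exact h3

/-- If the index is `m`, the regular elements are those whose stabiliser has dimension `m`; they are
detected by bordered determinants of the Lie–Poisson matrix. -/
theorem mem_regularLocus_iff [CharZero k] [DecidableEq ι]
    (b : Module.Basis ι k (lieAlg k A)) {m : ℕ} (hm : index k (lieAlg k A) = m)
    (ξ : Module.Dual k (lieAlg k A)) :
    ξ ∈ regularLocus b ↔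
      ∃ σ : Fin m → ι, eval (coords b ξ) (bordered (poissonMatrix b) σ) ≠ 0 := by
  have hrank : ∀ η, (formMatrix b η).rank + Module.finrank k (coadjointStabilizer η) =
      Fintype.card ι := fun η => by
    rw [finrank_coadjointStabilizer b, ← Module.finrank_fintype_fun_eq_card k]
    exact LinearMap.finrank_range_add_finrank_ker _
  obtain ⟨η₀, hη₀⟩ : ∃ η : Module.Dual k (lieAlg k A),
      Module.finrank k (coadjointStabilizer η) = m := by
    rw [← hm]
    exact Nat.sInf_mem (Set.range_nonempty _)
  have hmin : ∀ η : Module.Dual k (lieAlg k A),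
      m ≤ Module.finrank k (coadjointStabilizer η) := fun η => by
    rw [← hm]
    exact Nat.sInf_le ⟨η, rfl⟩
  have h1 : ξ ∈ regularLocus b ↔ Module.finrank k (coadjointStabilizer ξ) = m := by
    change (∀ η, dimension b (coadjointOrbit η) ≤ dimension b (coadjointOrbit ξ)) ↔ _
    simp only [dimension_coadjointOrbit, Nat.cast_le]
    have h2 := hrank ξ
    constructor
    · intro h
      have := h η₀
      have := hrank η₀
      have := hmin ξ
      omega
    · intro h η
      have := hrank η
      have := hmin η
      omega
  simp only [h1, map_bordered, poissonMatrix_map_eval]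
  rw [finrank_coadjointStabilizer b]
  constructor
  · intro h
    exact exists_bordered_ne_zero (formMatrix_transpose b ξ) (by rw [h, Fintype.card_fin])
  · rintro ⟨σ, hσ⟩
    have := finrank_ker_le_of_bordered_ne_zero hσ
    rw [Fintype.card_fin] at this
    exact le_antisymm this ((hmin ξ).trans_eq (finrank_coadjointStabilizer b ξ))

/-- The gradients of invariants lie in the kernel of the Lie–Poisson matrix. -/
theorem poissonMatrix_mul_jacobian {m : ℕ} {p : Fin m → MvPolynomial ι k}
    (hp : ∀ j, p j ∈ invariants b) : poissonMatrix b * jacobian p = 0 := by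
  ext1 i j
  have : Infinite k := IsAlgClosed.instInfinite
  refine MvPolynomial.funext fun x => ?_
  obtain ⟨ξ, rfl⟩ := (coords_bijective b).surjective x
  have h := sum_pderiv_mul_eq_zero_of_mem_invariants (hp j) ξ (b i)
  rw [mul_apply, map_sum, Matrix.zero_apply, map_zero, ← neg_eq_zero, ← Finset.sum_neg_distrib, ← h]
  refine Finset.sum_congr rfl fun l _ => ?_
  have h1 : eval (coords b ξ) (poissonMatrix b i l) = ξ ⁅b i, b l⁆ :=
    congrFun (congrFun (poissonMatrix_map_eval b ξ) i) l
  rw [map_mul, h1, ← lie_skew, map_neg, neg_mul, neg_neg, mul_comm]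
  rfl

end Orbits

end AlgGroup

end

/-! ### The codimension two conditions -/

theorem mainTheorem8 {k A ι : Type*} [Field k] [IsAlgClosed k] [CharZero k]
    [CommRing A] [HopfAlgebra k A] [Algebra.FiniteType k A] [IsReduced A]
    [ConnectedSpace (PrimeSpectrum A)]
    [Fintype ι] (b : Module.Basis ι k (AlgGroup.lieAlg k A))
    (m : ℕ) (p : Fin m → MvPolynomial ι k)
    (hindex : AlgGroup.index k (AlgGroup.lieAlg k A) = m)
    (hhom : ∀ j, (p j).IsHomogeneous (p j).totalDegree)
    (hind : AlgebraicIndependent k p)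
    (hgen : AlgGroup.invariants b = Algebra.adjoin k (Set.range p))
    (hdeg : ((∑ j, (p j).totalDegree : ℕ) : ℚ) =
      ((Module.finrank k (AlgGroup.lieAlg k A) : ℚ) +
        (AlgGroup.index k (AlgGroup.lieAlg k A) : ℚ)) / 2) :
    (2 ≤ AlgGroup.codim b (AlgGroup.regularLocus b)ᶜ ↔
      2 ≤ AlgGroup.codim b (AlgGroup.independenceLocus b p)ᶜ) ∧
    (2 ≤ AlgGroup.codim b (AlgGroup.regularLocus b)ᶜ →
      AlgGroup.regularLocus b = AlgGroup.independenceLocus b p) := by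
  classical
  have hp : ∀ j, p j ∈ AlgGroup.invariants b := fun j => by
    rw [hgen]
    exact Algebra.subset_adjoin ⟨j, rfl⟩
  have hn : Module.finrank k (AlgGroup.lieAlg k A) = Fintype.card ι :=
    Module.finrank_eq_card_basis b
  obtain ⟨σ₀, hσ₀⟩ := AlgGroup.exists_jacobian_det_ne_zero hind
  obtain ⟨ξ₀, hξ₀⟩ : ∃ ξ : Module.Dual k (AlgGroup.lieAlg k A),
      Module.finrank k (AlgGroup.coadjointStabilizer ξ) = m := by
    rw [← hindex]
    exact Nat.sInf_mem (Set.range_nonempty _)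
  have hmn : m ≤ Fintype.card ι := by
    have : FiniteDimensional k (AlgGroup.lieAlg k A) := b.finiteDimensional_of_finite
    rw [← hξ₀, ← hn]
    exact Submodule.finrank_le _
  have hdeg' : 2 * ∑ j, (p j).totalDegree = Fintype.card ι + m := by
    rw [hindex, hn] at hdeg
    have : ((2 * ∑ j, (p j).totalDegree : ℕ) : ℚ) = (Fintype.card ι + m : ℕ) := by
      push_cast at hdeg ⊢
      linarith
    exact_mod_cast this
  -- The degree hypothesis says that `n - m = 2 * d`.
  obtain ⟨d, hd⟩ : ∃ d, d + m = ∑ j, (p j).totalDegree := ⟨_, Nat.sub_add_cancel (by omega)⟩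
  have hR := AlgGroup.mem_regularLocus_iff b hindex
  have hY := AlgGroup.mem_independenceLocus_iff b p
  have hP0 : ∃ σ : Fin m → ι, AlgGroup.bordered (AlgGroup.poissonMatrix b) σ ≠ 0 := by
    obtain ⟨σ, hσ⟩ := AlgGroup.exists_bordered_ne_zero (κ := Fin m)
      (AlgGroup.formMatrix_transpose b ξ₀)
      (by rw [← AlgGroup.finrank_coadjointStabilizer, hξ₀, Fintype.card_fin])
    refine ⟨σ, fun h => hσ ?_⟩
    rw [← AlgGroup.poissonMatrix_map_eval, ← AlgGroup.map_bordered, h, map_zero]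
  have key := AlgGroup.nonvanishing_eq_of_codim (d := d)
    (P := fun σ : Fin m → ι => AlgGroup.bordered (AlgGroup.poissonMatrix b) σ)
    (Q := fun σ : Fin m → ι => ((AlgGroup.jacobian p).submatrix σ id).det)
    (fun σ => AlgGroup.isHomogeneous_bordered (AlgGroup.isHomogeneous_poissonMatrix b) σ
      (by rw [Fintype.card_fin]; omega))
    (fun σ => AlgGroup.isHomogeneous_jacobian_det hhom σ hd)
    (AlgGroup.bordered_mul_sq _ (AlgGroup.poissonMatrix_transpose b) _
      (AlgGroup.poissonMatrix_mul_jacobian hp)) hP0 ⟨σ₀, hσ₀⟩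
  have heq : 2 ≤ AlgGroup.codim b (AlgGroup.regularLocus b)ᶜ ∨
      2 ≤ AlgGroup.codim b (AlgGroup.independenceLocus b p)ᶜ →
      AlgGroup.regularLocus b = AlgGroup.independenceLocus b p := by
    intro h
    rw [AlgGroup.codim_compl b (U := {x | ∃ σ : Fin m → ι, MvPolynomial.eval x
      (AlgGroup.bordered (AlgGroup.poissonMatrix b) σ) ≠ 0}) hR,
      AlgGroup.codim_compl b (U := {x | ∃ σ : Fin m → ι, MvPolynomial.eval x
        ((AlgGroup.jacobian p).submatrix σ id).det ≠ 0}) hY] at h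
    ext ξ
    rw [hR, hY]
    exact Set.ext_iff.1 (key h) (AlgGroup.coords b ξ)
  exact ⟨⟨fun h => heq (.inl h) ▸ h, fun h => heq (.inr h) ▸ h⟩, fun h => heq (.inl h)⟩
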